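/- **Setting.** Let $\mathcal P=\{x\in\mathbb R^p: Cx\le d\}$ be a polytope (a bounded polyhedron) with at least two points, with rows $C_i$ of $C$, set of vertices $V$ and diameter $D$. Let $f_1,\dots,f_n:\mathbb R^p\to\mathbb R$ ($n\ge1$) be differentiable, $f_i$ strongly convex with parameter $\sigma_i>0$ and with $L_i$-Lipschitz gradient; put $F=\frac1n\sum_i f_i$, $F^*=\min_{\mathcal P}F$, $\sigma_F=\min_i\sigma_i$, $L_F=\max_iL_i$. Let $\Omega_{\mathcal P}$ be the smallest positive slack $d_i-C_iv$ over $v\in V$ and all $i$, divided by the largest $\|C_i\|$ over the constraints $i$ that are not active at every vertex. **Algorithm (PSFW).** Start at a vertex $x^{(1)}\in V$ with weights $\mu^{(1)}_{x^{(1)}}=1$, all others $0$. In iteration $k=1,2,\dots$ draw $m^{(k)}$ fresh independent uniform indices $\xi_1,\dots,\xi_{m^{(k)}}\in\{1,\dots,n\}$, let $F^{(k)}$ be the average of the $f_{\xi_i}$, $L^{(k)}$ the average of the $L_{\xi_i}$ and $g^{(k)}=\nabla F^{(k)}(x^{(k)})$ ($m^{(k)}$ stochastic gradient evaluations). Let $p^{(k)}\in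 V$ minimize $\langle g^{(k)},\cdot\rangle$ over $\mathcal P$, let $u^{(k)}$ maximize $\langle g^{(k)},\cdot\rangle$ over the active vertices (those of positive weight), put $d^{(k)}=p^{(k)}-u^{(k)}$, $\gamma_{\max}^{(k)}=\mu^{(k)}_{u^{(k)}}$, and let $\gamma^{(k)}$ be $\min\{-\langle g^{(k)},d^{(k)}\rangle/(L^{(k)}\|d^{(k)}\|^2),\gamma^{(k)}_{\max}\}$ ($0$ if $d^{(k)}=0$), or be chosen by exact line search for $F^{(k)}$ on $[0,\gamma_{\max}^{(k)}]$. Set $x^{(k+1)}=x^{(k)}+\gamma^{(k)}d^{(k)}$ and move the weight $\gamma^{(k)}$ from $u^{(k)}$ to $p^{(k)}$; in the Carathéodory version, this representation of $x^{(k+1)}$ is then replaced, if necessary, by one that uses at most $p+1$ vertices, all of them from it. Let $N=|V|$ without and $N=p+1$ with the Carathéodory reduction, and $$\rho=\min\Big\{\tfrac12,\tfrac{\Omega_{\mathcal P}^2\sigma_F}{16N^2L_FD^2}\Big\},\qquad \kappa=\min\Big\{\tfrac12,\tfrac{\Omega_{\mathcal P}^2\sigma_F}{8N^2L_FD^2}\Big\},\qquad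 m^{(k)}=\big\lceil (1-\kappa)^{-(2k+2)}\big\rceil .$$ **Corollary 5.** There are constants $\phi\in(0,\kappa)$, $C_3$ and $K$, depending only on the problem data ($C,d,f_i,\sigma_i,L_i$ and the version of the algorithm), such that $$0<\zeta:=\frac{\log(1-\rho)}{\log(1-\phi)}<1$$ and for every run of PSFW: (i) $\mathbb E\{F(x^{(k+1)})-F^*\}\le C_3(1-\phi)^{k/(3|V|!+1)}$ for all $k\ge1$; (ii) for every $0<\epsilon<1$ there is a first number $k\ge0$ of iterations with $\mathbb E\{F(x^{(k+1)})-F^*\}\le\epsilon$, and the number $\sum_{i=1}^k m^{(i)}$ of stochastic gradient evaluations made until then is at most $K\,(1/\epsilon)^{(6|V|!+2)\zeta}$. That is, PSFW needs $O\big((1/\epsilon)^{(6|V|!+2)\zeta}\big)$ stochastic gradient evaluations to reach an $\epsilon$-accurate solution. -/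

import Mathlib

open MeasureTheory ProbabilityTheory

namespace PSFW

noncomputable section

/-- `ℝ^p` with its Euclidean norm. -/
abbrev Eucl (p : ℕ) : Type := EuclideanSpace ℝ (Fin p)

/-! ### The polytope and its constants -/

/-- The polyhedron `{x | C x ≤ d}`; `C i` is the `i`-th row of the constraint matrix. -/
def polyhedron {p r : ℕ} (C : Fin r → Eucl p) (d : Fin r → ℝ) : Set (Eucl p) :=
  {x | ∀ i, inner ℝ (C i) x ≤ d i}

/-- The vertices (extreme points) of the polyhedron. -/
def vertices {p r : ℕ} (C : Fin r → Eucl p) (d : Fin r → ℝ) : Set (Eucl p) :=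
  (polyhedron C d).extremePoints ℝ

/-- The smallest positive slack `d i - ⟪C i, v⟫`, over all vertices `v` and constraints `i` that
are not active at `v`. -/
def minSlack {p r : ℕ} (C : Fin r → Eucl p) (d : Fin r → ℝ) : ℝ :=
  sInf {s | ∃ v ∈ vertices C d, ∃ i, inner ℝ (C i) v < d i ∧ s = d i - inner ℝ (C i) v}

/-- The largest norm of a row `C i`, over the constraints `i` that are not active at all
vertices. -/
def maxRowNorm {p r : ℕ} (C : Fin r → Eucl p) (d : Fin r → ℝ) : ℝ :=
  sSup {s | ∃ i, (∃ v ∈ vertices C d, inner ℝ (C i) v ≠ d i) ∧ s = ‖C i‖}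

/-- The vertex-facet constant `Ω_P` of the polytope. -/
def vertexFacetConst {p r : ℕ} (C : Fin r → Eucl p) (d : Fin r → ℝ) : ℝ :=
  minSlack C d / maxRowNorm C d

/-! ### The objective -/

/-- `F(x) = (1/n) ∑ᵢ fᵢ(x)`. -/
def objective {p n : ℕ} (f : Fin n → Eucl p → ℝ) (x : Eucl p) : ℝ :=
  (1 / (n : ℝ)) * ∑ i, f i x

/-- The optimal value `F^* = min_{x ∈ P} F(x)`. -/
def optValue {p r n : ℕ} (C : Fin r → Eucl p) (d : Fin r → ℝ) (f : Fin n → Eucl p → ℝ) : ℝ :=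
  sInf (objective f '' polyhedron C d)

/-! ### Parameters of the algorithm -/

/-- The two versions of the vertex representation update: without, and with, a final reduction by
Carathéodory's theorem. -/
inductive Variant where
  | plain
  | caratheodory

/-- The bound `N` on the number of vertices used to represent an iterate. -/
def repSize {p r : ℕ} (C : Fin r → Eucl p) (d : Fin r → ℝ) : Variant → ℕ
  | .plain => (vertices C d).ncard
  | .caratheodory => p + 1

/-- `min {1/2, Ω_P² σ_F / (c N² L_F D²)}` where `σ_F = minᵢ σᵢ`, `L_F = maxᵢ Lᵢ` and `D` is the
diameter of the polytope. -/
def contraction {p r n : ℕ} (c : ℝ) (C : Fin r → Eucl p) (d : Fin r → ℝ) (σ L : Fin n → ℝ)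
    (var : Variant) : ℝ :=
  min (1 / 2) (vertexFacetConst C d ^ 2 * (⨅ i, σ i) /
    (c * (repSize C d var : ℝ) ^ 2 * (⨆ i, L i) * Metric.diam (polyhedron C d) ^ 2))

/-- `ρ = min {1/2, Ω_P² σ_F / (16 N² L_F D²)}`. -/
def rho {p r n : ℕ} (C : Fin r → Eucl p) (d : Fin r → ℝ) (σ L : Fin n → ℝ) (var : Variant) : ℝ :=
  contraction 16 C d σ L var

/-- `κ = min {1/2, Ω_P² σ_F / (8 N² L_F D²)}`. -/
def kappa {p r n : ℕ} (C : Fin r → Eucl p) (d : Fin r → ℝ) (σ L : Fin n → ℝ) (var : Variant) : ℝ :=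
  contraction 8 C d σ L var

/-- The sample size `m^{(k)} = ⌈1 / (1 - κ)^{2k+2}⌉` of iteration `k`. -/
def sampleSize (κ : ℝ) (k : ℕ) : ℕ := ⌈1 / (1 - κ) ^ (2 * k + 2)⌉₊

/-- The number of stochastic gradients evaluated in the iterations `1, …, k`. -/
def gradEvals (κ : ℝ) (k : ℕ) : ℕ := ∑ i ∈ Finset.Icc 1 k, sampleSize κ i

/-! ### The algorithm -/

/-- The sampled objective `(1/m) ∑_{i < m} f_{s i}(x)`. -/
def sampledObjective {p n : ℕ} (f : Fin n → Eucl p → ℝ) (m : ℕ) (s : ℕ → Fin n) (x : Eucl p) : ℝ :=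
  (1 / (m : ℝ)) * ∑ i ∈ Finset.range m, f (s i) x

/-- The stochastic gradient `(1/m) ∑_{i < m} ∇f_{s i}(x)`. -/
def stochGrad {p n : ℕ} (f : Fin n → Eucl p → ℝ) (m : ℕ) (s : ℕ → Fin n) (x : Eucl p) : Eucl p :=
  (1 / (m : ℝ)) • ∑ i ∈ Finset.range m, gradient (f (s i)) x

/-- The sampled Lipschitz constant `(1/m) ∑_{i < m} L_{s i}`. -/
def sampledLip {n : ℕ} (L : Fin n → ℝ) (m : ℕ) (s : ℕ → Fin n) : ℝ :=
  (1 / (m : ℝ)) * ∑ i ∈ Finset.range m, L (s i)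

/-- The step size, for gradient `g`, smoothness constant `ℓ`, sampled objective `φ`, direction `dir`
and maximal step `γmax`: the explicit rule, or exact line search for `φ` on `[0, γmax]`. -/
def IsStepSize {p : ℕ} (φ : Eucl p → ℝ) (g : Eucl p) (ℓ : ℝ) (x dir : Eucl p) (γmax γ : ℝ) : Prop :=
  γ = min (-(inner ℝ g dir) / (ℓ * ‖dir‖ ^ 2)) γmax ∨
    (γ ∈ Set.Icc 0 γmax ∧ IsMinOn (fun t : ℝ => φ (x + t • dir)) (Set.Icc 0 γmax) γ)

/-- The weights after the pairwise step: the mass `γ` moves from the vertex `u` to the vertex `v`.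
The active vertices are the support of the weights. -/
def moveMass {p : ℕ} (μ : Eucl p →₀ ℝ) (v u : Eucl p) (γ : ℝ) : Eucl p →₀ ℝ :=
  μ + Finsupp.single v γ - Finsupp.single u γ

/-- `ν` is a Carathéodory reduction of the vertex representation `μ`: a convex combination of at
most `p + 1` vertices with the same value, which is `μ` itself or has lost some active vertices. -/
def IsCaratheodoryReduction {p : ℕ} (μ ν : Eucl p →₀ ℝ) : Prop :=
  (∀ v, 0 ≤ ν v) ∧ (ν.sum fun _ a => a) = 1 ∧
    (ν.sum fun v a => a • v) = (μ.sum fun v a => a • v) ∧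
    ν.support.card ≤ p + 1 ∧ (ν = μ ∨ ν.support ⊂ μ.support)

/-- The vertex representation update: `ν` may follow the output `μ` of the mass transfer. -/
def IsUpdate {p : ℕ} (μ ν : Eucl p →₀ ℝ) : Variant → Prop
  | .plain => ν = μ
  | .caratheodory => IsCaratheodoryReduction μ ν

/-- One sample path of the pairwise stochastic Frank-Wolfe algorithm, with sample sizes `m k` and
samples `s k i`, `i < m k`, at iteration `k = 1, 2, …`: iterates `x k`, weights `μ k`, vertices
`v k` (from the linear minimization oracle) and `u k` (the away vertex) and step sizes `γ k`. -/
structure IsRun {p r n : ℕ} (C : Fin r → Eucl p) (d : Fin r → ℝ) (f : Fin n → Eucl p → ℝ)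
    (L : Fin n → ℝ) (var : Variant) (m : ℕ → ℕ) (s : ℕ → ℕ → Fin n)
    (x : ℕ → Eucl p) (μ : ℕ → Eucl p →₀ ℝ) (v u : ℕ → Eucl p) (γ : ℕ → ℝ) : Prop where
  start_mem : x 1 ∈ vertices C d
  start_weights : μ 1 = Finsupp.single (x 1) 1
  oracle_mem : ∀ k, 1 ≤ k → v k ∈ vertices C d
  oracle_min : ∀ k, 1 ≤ k → ∀ y ∈ polyhedron C d,
    inner ℝ (stochGrad f (m k) (s k) (x k)) (v k) ≤ inner ℝ (stochGrad f (m k) (s k) (x k)) y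
  away_mem : ∀ k, 1 ≤ k → u k ∈ (μ k).support
  away_max : ∀ k, 1 ≤ k → ∀ y ∈ (μ k).support,
    inner ℝ (stochGrad f (m k) (s k) (x k)) y ≤ inner ℝ (stochGrad f (m k) (s k) (x k)) (u k)
  step_size : ∀ k, 1 ≤ k →
    IsStepSize (sampledObjective f (m k) (s k)) (stochGrad f (m k) (s k) (x k))
      (sampledLip L (m k) (s k)) (x k) (v k - u k) (μ k (u k)) (γ k)
  step : ∀ k, 1 ≤ k → x (k + 1) = x k + γ k • (v k - u k)
  update : ∀ k, 1 ≤ k → IsUpdate (moveMass (μ k) (v k) (u k) (γ k)) (μ (k + 1)) var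

/-- The algorithm as a random process: the samples `ξ k i` are independent and uniform on the
indices `1, …, n`, the iterates are random variables, and every sample path is a run with the
sample sizes `⌈1 / (1 - κ)^{2k+2}⌉`. -/
structure IsRandomRun {p r n : ℕ} (C : Fin r → Eucl p) (d : Fin r → ℝ) (f : Fin n → Eucl p → ℝ)
    (σ L : Fin n → ℝ) (var : Variant) {Ω : Type*} [MeasurableSpace Ω] (P : Measure Ω)
    (ξ : ℕ → ℕ → Ω → Fin n) (x : ℕ → Ω → Eucl p) (μ : ℕ → Ω → Eucl p →₀ ℝ)
    (v u : ℕ → Ω → Eucl p) (γ : ℕ → Ω → ℝ) : Prop where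
  sample_measurable : ∀ k i, Measurable (ξ k i)
  sample_indep : iIndepFun (fun (q : ℕ × ℕ) => ξ q.1 q.2) P
  sample_uniform : ∀ k i (j : Fin n), P.real {ω | ξ k i ω = j} = 1 / (n : ℝ)
  iterate_measurable : ∀ k, 1 ≤ k → Measurable (x k)
  run : ∀ ω, IsRun C d f L var (sampleSize (kappa C d σ L var)) (fun k i => ξ k i ω)
    (fun k => x k ω) (fun k => μ k ω) (fun k => v k ω) (fun k => u k ω) (fun k => γ k ω)

/-- The expected accuracy `E[F(x^{(k+1)}) - F^*]` after `k` iterations. -/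
def expectedGap {p r n : ℕ} (C : Fin r → Eucl p) (d : Fin r → ℝ) (f : Fin n → Eucl p → ℝ)
    {Ω : Type*} [MeasurableSpace Ω] (P : Measure Ω) (x : ℕ → Ω → Eucl p) (k : ℕ) : ℝ :=
  ∫ ω, (objective f (x (k + 1) ω) - optValue C d f) ∂P

end

end PSFW

/-! The argument is pathwise until the very end. Call the ℓ¹ distance between the empirical
frequencies of a sample and the uniform law its deviation. The summands are Lipschitz on the
polytope, so sampled minus true objective is Lipschitz there with a constant proportional to the
deviation (`abs_sampled_sub_objective_sub_le`).

The pairwise gap ⟨g, u - v⟩ controls the slope ⟨g, x - y⟩ through Ω and N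
(`vertexFacetConst_mul_inner_le`). With strong convexity, a step that is not cut off contracts the
accuracy by the factor 1 - 8κ, up to a multiple of the deviation. A maximal step can be arbitrarily
short and has no such rate. But either the accuracy is already of the order of the deviation, or the
sampled decrease, proportional to γ, beats the sampling error, also proportional to γ, and the true
objective strictly decreases (`IsSmoothStrong.progress`). Along consecutive steps of the latter kind
no weight vector repeats, and each step loses an active vertex or carries an existing weight to a
free vertex. So at most ∑ₛ |V|!/(|V| - s)! ≤ 3|V|! weight vectors occur
(`length_le_of_isDropOrSwap`), and every window of B = 3|V|! iterations contains a contraction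
(`IsRun.contraction_window`).

The mean deviation of m samples is O(m^(-1/2)), hence O((1 - κ)^k) in iteration k. It does not
involve the iterate, so no conditioning on the past is needed. The recursion e(k + B) ≤ (1 - 8κ)
e(k) + E (1 - κ)^k gives decay like τ^k with τ = (1 - κ)^(2/(B + 1)) (`le_rate_pow_of_window`). The
work of k iterations is O((1 - κ)^(-2k)) = O(τ^(-(B + 1)k)), so accuracy ε costs O(ε^(-(B + 1))).
Finally the minima in κ and ρ are never attained by 1/2, so κ = 2ρ, and φ = 1 - (1 - ρ)² makes ζ =
1/2 and (6|V|! + 2)ζ = B + 1. -/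

namespace PSFW

/-! ### Polytope geometry: vertices, the vertex-facet constant, mass transport. -/

section Geometry

variable {p r : ℕ} {C : Fin r → Eucl p} {d : Fin r → ℝ}

lemma isClosed_polyhedron : IsClosed (polyhedron C d) := by
  have : polyhedron C d = ⋂ i, {x | inner ℝ (C i) x ≤ d i} := by
    ext x; simp [polyhedron]
  rw [this]
  exact isClosed_iInter fun i => isClosed_le (by fun_prop) continuous_const

lemma convex_polyhedron : Convex ℝ (polyhedron C d) := by
  intro x hx y hy a b ha hb hab i
  rw [inner_add_right, inner_smul_right, inner_smul_right]
  calc a * inner ℝ (C i) x + b * inner ℝ (C i) y ≤ a * d i + b * d i :=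
        add_le_add (mul_le_mul_of_nonneg_left (hx i) ha) (mul_le_mul_of_nonneg_left (hy i) hb)
    _ = d i := by rw [← add_mul, hab, one_mul]

lemma isCompact_polyhedron (hbdd : Bornology.IsBounded (polyhedron C d)) :
    IsCompact (polyhedron C d) :=
  Metric.isCompact_of_isClosed_isBounded isClosed_polyhedron hbdd

lemma vertices_subset : vertices C d ⊆ polyhedron C d := extremePoints_subset

/-- A direction that does not leave the active constraints is feasible for a short time. -/
lemma eventually_add_smul_mem {x e : Eucl p} (hx : x ∈ polyhedron C d)
    (he : ∀ i, inner ℝ (C i) x = d i → inner ℝ (C i) e ≤ 0) :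
    ∀ᶠ t in nhdsWithin (0 : ℝ) (Set.Ioi 0), x + t • e ∈ polyhedron C d := by
  change ∀ᶠ t in nhdsWithin (0 : ℝ) (Set.Ioi 0), ∀ i, inner ℝ (C i) (x + t • e) ≤ d i
  rw [Filter.eventually_all]
  intro i
  rcases (hx i).eq_or_lt with h | h
  · filter_upwards [self_mem_nhdsWithin] with t ht
    rw [inner_add_right, inner_smul_right, h]
    have := mul_nonpos_of_nonneg_of_nonpos (le_of_lt ht) (he i h)
    linarith
  · have hc : ContinuousAt (fun t : ℝ => (inner ℝ (C i) (x + t • e) : ℝ)) 0 := by fun_prop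
    have : ∀ᶠ t in nhds (0 : ℝ), inner ℝ (C i) (x + t • e) < d i :=
      hc.eventually_lt continuousAt_const (by simpa using h)
    filter_upwards [this.filter_mono nhdsWithin_le_nhds] with t ht using ht.le

/-- A vertex is determined by its active constraints. -/
lemma exists_active_not_active {v w : Eucl p} (hv : v ∈ vertices C d)
    (hw : w ∈ polyhedron C d) (hne : v ≠ w) :
    ∃ i, inner ℝ (C i) v = d i ∧ inner ℝ (C i) w < d i := by
  by_contra hcon
  push Not at hcon
  have hact : ∀ i, inner ℝ (C i) v = d i → inner ℝ (C i) w = d i := fun i hi =>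
    le_antisymm (hw i) (hcon i hi)
  -- If all constraints active at v are active at w, both directions ±(w - v) are feasible at v,
  -- which is then the midpoint of a segment in the polytope.
  have h1 := eventually_add_smul_mem (e := w - v) (vertices_subset hv) (fun i hi => by
    rw [inner_sub_right, hi, hact i hi]; simp)
  have h2 := eventually_add_smul_mem (e := v - w) (vertices_subset hv) (fun i hi => by
    rw [inner_sub_right, hi, hact i hi]; simp)
  obtain ⟨t, ⟨ht1, ht2⟩, ht⟩ := ((h1.and h2).and self_mem_nhdsWithin).exists
  have ht0 : (0 : ℝ) < t := ht
  have hseg : v ∈ openSegment ℝ (v + t • (w - v)) (v + t • (v - w)) := by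
    refine ⟨1 / 2, 1 / 2, by norm_num, by norm_num, by norm_num, ?_⟩
    module
  have := (mem_extremePoints.1 hv).2 _ ht1 _ ht2 hseg
  have h3 : t • (w - v) = 0 := by simpa using this.1
  rcases smul_eq_zero.1 h3 with h | h
  · exact ht0.ne' h
  · exact hne (sub_eq_zero.1 h).symm

lemma finite_vertices : (vertices C d).Finite := by
  classical
  refine Set.Finite.of_finite_image (f := fun v => Finset.univ.filter
    fun i => inner ℝ (C i) v = d i) (Set.toFinite _) ?_
  intro v hv w hw hvw
  by_contra hne
  obtain ⟨i, hi, hi'⟩ := exists_active_not_active hv (vertices_subset hw) hne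
  have : i ∈ Finset.univ.filter fun i => inner ℝ (C i) w = d i := by
    refine (Finset.ext_iff.1 hvw i).1 ?_
    simp [hi]
  simp only [Finset.mem_filter, Finset.mem_univ, true_and] at this
  exact hi'.ne this

/-- Krein–Milman: from at most one vertex the closed convex hull is at most a point. -/
lemma nontrivial_vertices (hbdd : Bornology.IsBounded (polyhedron C d))
    (hnt : (polyhedron C d).Nontrivial) : (vertices C d).Nontrivial := by
  by_contra hcon
  rw [Set.not_nontrivial_iff] at hcon
  have hkm := closure_convexHull_extremePoints (isCompact_polyhedron hbdd)
    (convex_polyhedron (C := C) (d := d))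
  change closure (convexHull ℝ (vertices C d)) = _ at hkm
  rcases hcon.eq_empty_or_singleton with h | ⟨v, h⟩
  · rw [h] at hkm
    simp only [convexHull_empty, closure_empty] at hkm
    rw [← hkm] at hnt
    exact Set.not_nontrivial_empty hnt
  · rw [h] at hkm
    simp only [convexHull_singleton, closure_singleton] at hkm
    rw [← hkm] at hnt
    exact Set.not_nontrivial_singleton hnt

lemma finite_slacks : {s : ℝ | ∃ v ∈ vertices C d, ∃ i, inner ℝ (C i) v < d i ∧
    s = d i - inner ℝ (C i) v}.Finite := by
  refine ((finite_vertices (C := C) (d := d)).prod (Set.finite_univ (α := Fin r))).image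
    (fun q : Eucl p × Fin r => d q.2 - inner ℝ (C q.2) q.1) |>.subset ?_
  rintro s ⟨v, hv, i, -, rfl⟩
  exact ⟨(v, i), ⟨hv, trivial⟩, rfl⟩

lemma finite_rowNorms : {s : ℝ | ∃ i, (∃ v ∈ vertices C d, inner ℝ (C i) v ≠ d i) ∧
    s = ‖C i‖}.Finite := by
  refine (Set.finite_range fun i => ‖C i‖).subset ?_
  rintro s ⟨i, -, rfl⟩
  exact ⟨i, rfl⟩

lemma minSlack_le {v : Eucl p} (hv : v ∈ vertices C d) {i : Fin r} (hi : inner ℝ (C i) v < d i) :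
    minSlack C d ≤ d i - inner ℝ (C i) v :=
  csInf_le finite_slacks.bddBelow ⟨v, hv, i, hi, rfl⟩

lemma norm_le_maxRowNorm {v : Eucl p} (hv : v ∈ vertices C d) {i : Fin r}
    (hi : inner ℝ (C i) v < d i) : ‖C i‖ ≤ maxRowNorm C d :=
  le_csSup finite_rowNorms.bddAbove ⟨i, ⟨v, hv, hi.ne⟩, rfl⟩

lemma exists_separating_row (hbdd : Bornology.IsBounded (polyhedron C d))
    (hnt : (polyhedron C d).Nontrivial) :
    ∃ v ∈ vertices C d, ∃ w ∈ vertices C d, ∃ i, inner ℝ (C i) v = d i ∧ inner ℝ (C i) w < d i := by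
  obtain ⟨v, hv, w, hw, hne⟩ := nontrivial_vertices hbdd hnt
  obtain ⟨i, h⟩ := exists_active_not_active hv (vertices_subset hw) hne
  exact ⟨v, hv, w, hw, i, h⟩

lemma minSlack_pos (hbdd : Bornology.IsBounded (polyhedron C d))
    (hnt : (polyhedron C d).Nontrivial) : 0 < minSlack C d := by
  obtain ⟨v, hv, w, hw, i, hi, hi'⟩ := exists_separating_row hbdd hnt
  have hne : {s : ℝ | ∃ v ∈ vertices C d, ∃ i, inner ℝ (C i) v < d i ∧
    s = d i - inner ℝ (C i) v}.Nonempty := ⟨_, w, hw, i, hi', rfl⟩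
  obtain ⟨v, -, i, hlt, heq⟩ := hne.csInf_mem finite_slacks
  rw [minSlack, heq]
  linarith

lemma norm_sub_le_diam (hbdd : Bornology.IsBounded (polyhedron C d)) {x y : Eucl p}
    (hx : x ∈ polyhedron C d) (hy : y ∈ polyhedron C d) :
    ‖x - y‖ ≤ Metric.diam (polyhedron C d) := by
  rw [← dist_eq_norm]
  exact Metric.dist_le_diam_of_mem hbdd hx hy

lemma diam_polyhedron_pos (hbdd : Bornology.IsBounded (polyhedron C d))
    (hnt : (polyhedron C d).Nontrivial) : 0 < Metric.diam (polyhedron C d) := by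
  obtain ⟨x, hx, y, hy, hne⟩ := hnt
  exact (norm_pos_iff.2 (sub_ne_zero.2 hne)).trans_le (norm_sub_le_diam hbdd hx hy)

lemma maxRowNorm_pos (hbdd : Bornology.IsBounded (polyhedron C d))
    (hnt : (polyhedron C d).Nontrivial) : 0 < maxRowNorm C d := by
  obtain ⟨v, hv, w, hw, i, hi, hi'⟩ := exists_separating_row hbdd hnt
  refine lt_of_lt_of_le (norm_pos_iff.2 ?_) (norm_le_maxRowNorm hw hi')
  intro h0
  simp only [h0, inner_zero_left] at hi hi'
  linarith

lemma vertexFacetConst_pos (hbdd : Bornology.IsBounded (polyhedron C d))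
    (hnt : (polyhedron C d).Nontrivial) : 0 < vertexFacetConst C d :=
  div_pos (minSlack_pos hbdd hnt) (maxRowNorm_pos hbdd hnt)

/-- A row active at v but not at w has slack at most ‖C i‖ ‖v - w‖ at w. This is what keeps the
minima in κ and ρ away from 1/2. -/
lemma vertexFacetConst_le_diam (hbdd : Bornology.IsBounded (polyhedron C d))
    (hnt : (polyhedron C d).Nontrivial) :
    vertexFacetConst C d ≤ Metric.diam (polyhedron C d) := by
  obtain ⟨v, hv, w, hw, i, hi, hi'⟩ := exists_separating_row hbdd hnt
  rw [vertexFacetConst, div_le_iff₀ (maxRowNorm_pos hbdd hnt)]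
  calc minSlack C d ≤ d i - inner ℝ (C i) w := minSlack_le hw hi'
    _ = inner ℝ (C i) (v - w) := by rw [inner_sub_right, hi]
    _ ≤ ‖C i‖ * ‖v - w‖ := real_inner_le_norm _ _
    _ ≤ maxRowNorm C d * Metric.diam (polyhedron C d) :=
        mul_le_mul (norm_le_maxRowNorm hw hi')
          (norm_sub_le_diam hbdd (vertices_subset hv) (vertices_subset hw)) (norm_nonneg _)
          (maxRowNorm_pos hbdd hnt).le
    _ = _ := mul_comm _ _

lemma eq_zero_of_recession (hbdd : Bornology.IsBounded (polyhedron C d)) {x e : Eucl p}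
    (hx : x ∈ polyhedron C d) (he : ∀ i, inner ℝ (C i) e ≤ 0) : e = 0 := by
  by_contra hne
  have hpos : 0 < ‖e‖ := norm_pos_iff.2 hne
  set D := Metric.diam (polyhedron C d)
  have hD : 0 ≤ D := Metric.diam_nonneg
  have hmem : x + ((D + 1) / ‖e‖) • e ∈ polyhedron C d := fun i => by
    rw [inner_add_right, inner_smul_right]
    have := mul_nonpos_of_nonneg_of_nonpos (by positivity : 0 ≤ (D + 1) / ‖e‖) (he i)
    linarith [hx i]
  have := norm_sub_le_diam hbdd hmem hx
  rw [add_sub_cancel_left, norm_smul, Real.norm_of_nonneg (by positivity),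
    div_mul_cancel₀ _ hpos.ne'] at this
  linarith

/-- The mass that has to be moved from the vertices `U` in order to reach a point `y` from `x`. -/
lemma exists_transport (hbdd : Bornology.IsBounded (polyhedron C d))
    (hnt : (polyhedron C d).Nontrivial) {U : Finset (Eucl p)} (hU : ∀ v ∈ U, v ∈ vertices C d)
    {a : Eucl p → ℝ} (ha : ∀ v ∈ U, 0 ≤ a v) (ha1 : ∑ v ∈ U, a v = 1) {x y : Eucl p}
    (hx : ∑ v ∈ U, a v • v = x) (hy : y ∈ polyhedron C d) :
    ∃ t : Eucl p → ℝ, (∀ v ∈ U, 0 ≤ t v) ∧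
      (∀ i, inner ℝ (C i) (y - x) ≤ ∑ v ∈ U, t v * (d i - inner ℝ (C i) v)) ∧
      ∀ v ∈ U, vertexFacetConst C d * t v ≤ ‖x - y‖ := by
  classical
  -- The last condition says that y - x + ∑ t v • v satisfies the constraints scaled by ∑ t v: mass
  -- t v leaves each v and is placed elsewhere in the polytope, which turns x into y. The bound ∑ t
  -- v ≤ 1 only serves compactness.
  set K : Set (U → ℝ) := {t | (∀ v, 0 ≤ t v) ∧ ∑ v, t v ≤ 1 ∧
    ∀ i, inner ℝ (C i) (y - x) ≤ ∑ v : U, t v * (d i - inner ℝ (C i) v.1)} with hK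
  have hKc : IsCompact K := by
    refine Metric.isCompact_of_isClosed_isBounded ?_ ?_
    · have h1 : IsClosed {t : U → ℝ | ∀ v, 0 ≤ t v} := by
        simp only [Set.ofPred_forall]
        exact isClosed_iInter fun v => isClosed_le continuous_const (continuous_apply v)
      have h2 : IsClosed {t : U → ℝ | ∑ v, t v ≤ 1} :=
        isClosed_le (by fun_prop) continuous_const
      have h3 : IsClosed {t : U → ℝ | ∀ i, inner ℝ (C i) (y - x) ≤
          ∑ v : U, t v * (d i - inner ℝ (C i) v.1)} := by
        simp only [Set.ofPred_forall]
        exact isClosed_iInter fun i => isClosed_le continuous_const (by fun_prop)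
      exact h1.inter (h2.inter h3)
    · refine (Metric.isBounded_Icc (0 : U → ℝ) 1).subset ?_
      rintro t ⟨h0, h1, -⟩
      refine ⟨h0, fun v => ?_⟩
      exact (Finset.single_le_sum (fun w _ => h0 w) (Finset.mem_univ v)).trans h1
  -- Moving all the mass to y is admissible.
  have hKn : K.Nonempty := by
    refine ⟨fun v => a v, fun v => ha v v.2, ?_, fun i => ?_⟩
    · rw [Finset.sum_coe_sort U a, ha1]
    · rw [Finset.sum_coe_sort U fun v => a v * (d i - inner ℝ (C i) v)]
      have : ∑ v ∈ U, a v * (d i - inner ℝ (C i) v) = d i - inner ℝ (C i) x := by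
        rw [← hx, inner_sum]
        simp only [mul_sub, Finset.sum_sub_distrib, inner_smul_right, ← Finset.sum_mul, ha1,
          one_mul]
      rw [this, inner_sub_right]
      linarith [hy i]
  obtain ⟨t, ⟨ht0, ht1, htC⟩, hmin⟩ := hKc.exists_isMinOn hKn
    (f := fun t : U → ℝ => ∑ v, t v) (by fun_prop)
  have key : ∀ v, vertexFacetConst C d * t v ≤ ‖x - y‖ := by
    intro v
    rcases (ht0 v).eq_or_lt with h | h
    · rw [← h]; simp
    have hslack : ∀ w : U, ∀ i, 0 ≤ d i - inner ℝ (C i) w.1 := fun w i =>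
      sub_nonneg.2 (vertices_subset (hU w w.2) i)
    -- Least total mass forces a tight constraint with positive slack at v; otherwise t v could be
    -- lowered by some ε > 0. Tightness then bounds t v times that slack by ‖C i‖ ‖y - x‖.
    obtain ⟨i, hi, htight⟩ : ∃ i, inner ℝ (C i) v.1 < d i ∧
        ∑ w : U, t w * (d i - inner ℝ (C i) w.1) = inner ℝ (C i) (y - x) := by
      by_contra hcon
      push Not at hcon
      have hev : ∀ᶠ ε in nhdsWithin (0 : ℝ) (Set.Ioi 0), ∀ i, inner ℝ (C i) (y - x) ≤
          ∑ w : U, t w * (d i - inner ℝ (C i) w.1) - ε * (d i - inner ℝ (C i) v.1) := by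
        rw [Filter.eventually_all]
        intro i
        rcases (vertices_subset (hU v v.2) i).eq_or_lt with h' | h'
        · refine Filter.Eventually.of_forall fun ε => ?_
          rw [h', sub_self, mul_zero, sub_zero]
          exact htC i
        · have hlt := lt_of_le_of_ne (htC i) (hcon i h').symm
          have hc : ContinuousAt (fun ε : ℝ => ∑ w : U, t w * (d i - inner ℝ (C i) w.1) -
            ε * (d i - inner ℝ (C i) v.1)) 0 := by fun_prop
          have := continuousAt_const.eventually_lt hc (by simpa using hlt)
          filter_upwards [this.filter_mono nhdsWithin_le_nhds] with ε hε using hε.le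
      have hev2 : ∀ᶠ ε in nhdsWithin (0 : ℝ) (Set.Ioi 0), ε < t v :=
        (eventually_lt_nhds h).filter_mono nhdsWithin_le_nhds
      obtain ⟨ε, ⟨hε1, hε2⟩, hε⟩ := ((hev.and hev2).and self_mem_nhdsWithin).exists
      have hε0 : (0 : ℝ) < ε := hε
      have hsum : ∀ c : U → ℝ, ∑ w, (t w - if w = v then ε else 0) * c w =
          ∑ w, t w * c w - ε * c v := by
        intro c
        simp [sub_mul, Finset.sum_sub_distrib, ite_mul]
      have hsum1 : ∑ w, (t w - if w = v then ε else 0) = ∑ w, t w - ε := by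
        simp [Finset.sum_sub_distrib]
      have hmem : (fun w => t w - if w = v then ε else 0) ∈ K := by
        refine ⟨fun w => ?_, ?_, fun i => ?_⟩
        · dsimp only
          split_ifs with hw
          · rw [hw]; linarith
          · simp [ht0 w]
        · rw [hsum1]; linarith
        · rw [hsum]; exact hε1 i
      have := hmin hmem
      simp only [Set.mem_ofPred_eq, hsum1] at this
      linarith
    have h1 : t v * (d i - inner ℝ (C i) v.1) ≤ inner ℝ (C i) (y - x) := by
      rw [← htight]
      exact Finset.single_le_sum (f := fun w : U => t w * (d i - inner ℝ (C i) w.1))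
        (fun w _ => mul_nonneg (ht0 w) (hslack w i)) (Finset.mem_univ v)
    rw [vertexFacetConst, div_mul_eq_mul_div, div_le_iff₀ (maxRowNorm_pos hbdd hnt)]
    calc minSlack C d * t v ≤ (d i - inner ℝ (C i) v.1) * t v :=
          mul_le_mul_of_nonneg_right (minSlack_le (hU v v.2) hi) h.le
      _ = t v * (d i - inner ℝ (C i) v.1) := mul_comm _ _
      _ ≤ inner ℝ (C i) (y - x) := h1
      _ ≤ ‖C i‖ * ‖y - x‖ := real_inner_le_norm _ _
      _ ≤ maxRowNorm C d * ‖y - x‖ :=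
          mul_le_mul_of_nonneg_right (norm_le_maxRowNorm (hU v v.2) hi) (norm_nonneg _)
      _ = ‖x - y‖ * maxRowNorm C d := by rw [mul_comm, norm_sub_rev]
  refine ⟨fun v => if h : v ∈ U then t ⟨v, h⟩ else 0, fun v hv => ?_, fun i => ?_, fun v hv => ?_⟩
  · simp only [hv, dif_pos, ht0]
  · refine (htC i).trans_eq ?_
    rw [← Finset.sum_coe_sort U]
    simp
  · simpa only [hv, dif_pos] using key ⟨v, hv⟩

/-- The pairwise Frank-Wolfe gap dominates the slope towards any point of the polytope. -/
lemma vertexFacetConst_mul_inner_le (hbdd : Bornology.IsBounded (polyhedron C d))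
    (hnt : (polyhedron C d).Nontrivial) {U : Finset (Eucl p)} (hU : ∀ v ∈ U, v ∈ vertices C d)
    {a : Eucl p → ℝ} (ha : ∀ v ∈ U, 0 ≤ a v) (ha1 : ∑ v ∈ U, a v = 1) {x y : Eucl p}
    (hx : ∑ v ∈ U, a v • v = x) (hy : y ∈ polyhedron C d) {g u v : Eucl p}
    (hu : ∀ w ∈ U, inner ℝ g w ≤ inner ℝ g u)
    (hv : ∀ z ∈ polyhedron C d, inner ℝ g v ≤ inner ℝ g z)
    {N : ℕ} (hN : U.card ≤ N) :
    vertexFacetConst C d * inner ℝ g (x - y) ≤ N * ‖x - y‖ * (inner ℝ g u - inner ℝ g v) := by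
  obtain ⟨t, ht0, htC, htb⟩ := exists_transport hbdd hnt hU ha ha1 hx hy
  have hxP : x ∈ polyhedron C d := by
    rw [← hx]
    exact convex_polyhedron.sum_mem ha ha1 fun v hv => vertices_subset (hU v hv)
  have hgap : 0 ≤ inner ℝ g u - inner ℝ g v := by
    have hUne : U.Nonempty := by
      by_contra h
      rw [Finset.not_nonempty_iff_eq_empty] at h
      simp [h] at ha1
    obtain ⟨w, hw⟩ := hUne
    linarith [hu w hw, hv w (vertices_subset (hU w hw))]
  set S := ∑ v ∈ U, t v with hS
  have hS0 : 0 ≤ S := Finset.sum_nonneg ht0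
  have hinner : inner ℝ g (x - y) ≤ S * (inner ℝ g u - inner ℝ g v) := by
    rcases hS0.eq_or_lt with h | h
    · have ht : ∀ v ∈ U, t v = 0 := (Finset.sum_eq_zero_iff_of_nonneg ht0).1 h.symm
      have : y - x = 0 := eq_zero_of_recession hbdd hxP fun i => by
        refine (htC i).trans_eq (Finset.sum_eq_zero fun v hv => ?_)
        rw [ht v hv, zero_mul]
      rw [← h, ← neg_sub, this]
      simp
    -- The point z receives the moved mass S, so x - y = ∑ t v • v - S • z. Compare each v with the
    -- away vertex and z with the oracle vertex.
    · set z : Eucl p := S⁻¹ • (y - x + ∑ v ∈ U, t v • v) with hz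
      have hSz : S • z = y - x + ∑ v ∈ U, t v • v := by
        rw [hz, smul_inv_smul₀ h.ne']
      have hzP : z ∈ polyhedron C d := fun i => by
        rw [hz, inner_smul_right, inv_mul_le_iff₀ h, inner_add_right, inner_sum]
        have := htC i
        simp only [mul_sub, Finset.sum_sub_distrib, ← Finset.sum_mul] at this
        simp only [inner_smul_right]
        linarith
      have h1 : x - y = ∑ v ∈ U, t v • v - S • z := by rw [hSz]; abel
      rw [h1, inner_sub_right, inner_sum, inner_smul_right, mul_sub]
      refine sub_le_sub ?_ (mul_le_mul_of_nonneg_left (hv z hzP) hS0)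
      rw [hS, Finset.sum_mul]
      refine Finset.sum_le_sum fun w hw => ?_
      rw [inner_smul_right]
      exact mul_le_mul_of_nonneg_left (hu w hw) (ht0 w hw)
  have hSb : vertexFacetConst C d * S ≤ N * ‖x - y‖ := by
    rw [hS, Finset.mul_sum]
    calc ∑ v ∈ U, vertexFacetConst C d * t v ≤ ∑ _v ∈ U, ‖x - y‖ := Finset.sum_le_sum htb
      _ = U.card * ‖x - y‖ := by simp
      _ ≤ N * ‖x - y‖ := by gcongr
  calc vertexFacetConst C d * inner ℝ g (x - y)
      ≤ vertexFacetConst C d * (S * (inner ℝ g u - inner ℝ g v)) :=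
        mul_le_mul_of_nonneg_left hinner (vertexFacetConst_pos hbdd hnt).le
    _ = vertexFacetConst C d * S * (inner ℝ g u - inner ℝ g v) := by ring
    _ ≤ _ := mul_le_mul_of_nonneg_right hSb hgap

end Geometry

/-! ### Strong convexity, smoothness and sampled objectives. -/

noncomputable section Functions

section Single

variable {p : ℕ} {f : Eucl p → ℝ}

lemma hasDerivAt_line (hf : Differentiable ℝ f) (x z : Eucl p) (t : ℝ) :
    HasDerivAt (fun t : ℝ => f (x + t • z)) (inner ℝ (gradient f (x + t • z)) z) t := by
  have h1 : HasDerivAt (fun t : ℝ => x + t • z) z t := by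
    simpa using ((hasDerivAt_id t).smul_const z).const_add x
  have h2 := (hf (x + t • z)).hasGradientAt.hasFDerivAt
  exact (h2.comp_hasDerivAt t h1).congr_deriv (by simp)

/-- The first-order inequality of a strongly convex function. -/
lemma strongConvex_gradient_le {σ : ℝ} (hc : StrongConvexOn Set.univ σ f)
    (hf : Differentiable ℝ f) (x y : Eucl p) :
    f x + inner ℝ (gradient f x) (y - x) + σ / 2 * ‖y - x‖ ^ 2 ≤ f y := by
  have h0 := hasDerivAt_line hf x (y - x) 0
  simp only [zero_smul, add_zero] at h0
  have hslope := (hasDerivAt_iff_tendsto_slope_zero.1 h0).mono_left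
    (nhdsWithin_mono 0 fun t (ht : t ∈ Set.Ioi (0 : ℝ)) => ne_of_gt ht)
  have hbound : Filter.Tendsto (fun t : ℝ => f y - f x - (1 - t) * (σ / 2 * ‖y - x‖ ^ 2))
      (nhdsWithin 0 (Set.Ioi 0)) (nhds (f y - f x - (1 - 0) * (σ / 2 * ‖y - x‖ ^ 2))) := by
    refine Filter.Tendsto.mono_left ?_ nhdsWithin_le_nhds
    exact Continuous.tendsto (by fun_prop) 0
  -- Strong convexity at x + t(y - x), divided by t, in the limit t → 0⁺.
  have hle := le_of_tendsto_of_tendsto hslope hbound (by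
    have h1 : ∀ᶠ t in nhdsWithin (0 : ℝ) (Set.Ioi 0), t < 1 :=
      (eventually_lt_nhds one_pos).filter_mono nhdsWithin_le_nhds
    filter_upwards [h1, self_mem_nhdsWithin] with t ht1 ht0
    have ht0' : (0 : ℝ) < t := ht0
    have h2 := hc.2 (Set.mem_univ x) (Set.mem_univ y) (by linarith : (0 : ℝ) ≤ 1 - t) ht0'.le
      (by ring)
    have h3 : (1 - t) • x + t • y = x + t • (y - x) := by module
    rw [h3, norm_sub_rev] at h2
    simp only [zero_add, zero_smul, add_zero, smul_eq_mul] at h2 ⊢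
    rw [inv_mul_le_iff₀ ht0']
    nlinarith)
  linarith

/-- The descent lemma. -/
lemma le_of_lipschitz_gradient {L : ℝ} (hf : Differentiable ℝ f)
    (hL : ∀ x y, ‖gradient f x - gradient f y‖ ≤ L * ‖x - y‖) (x z : Eucl p) :
    f (x + z) ≤ f x + inner ℝ (gradient f x) z + L / 2 * ‖z‖ ^ 2 := by
  -- Subtracting the quadratic model leaves a function whose derivative is nonpositive on (0, 1) by
  -- the Lipschitz bound.
  set h : ℝ → ℝ := fun t => f (x + t • z) - t * inner ℝ (gradient f x) z -
    t ^ 2 * (L / 2 * ‖z‖ ^ 2) with hh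
  have hderiv : ∀ t, HasDerivAt h (inner ℝ (gradient f (x + t • z)) z -
      inner ℝ (gradient f x) z - 2 * t * (L / 2 * ‖z‖ ^ 2)) t := by
    intro t
    have h1 := (hasDerivAt_id t).mul_const (inner ℝ (gradient f x) z)
    have h2 := (hasDerivAt_pow 2 t).mul_const (L / 2 * ‖z‖ ^ 2)
    exact (((hasDerivAt_line hf x z t).sub h1).sub h2).congr_deriv (by simp)
  have hanti : AntitoneOn h (Set.Icc 0 1) := by
    refine antitoneOn_of_deriv_nonpos (convex_Icc 0 1)
      (fun t _ => (hderiv t).continuousAt.continuousWithinAt)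
      (fun t _ => (hderiv t).differentiableAt.differentiableWithinAt) fun t ht => ?_
    rw [interior_Icc] at ht
    rw [(hderiv t).deriv, ← inner_sub_left]
    have h1 := real_inner_le_norm (gradient f (x + t • z) - gradient f x) z
    have h2 := hL (x + t • z) x
    rw [add_sub_cancel_left, norm_smul, Real.norm_of_nonneg ht.1.le] at h2
    have h3 := mul_le_mul_of_nonneg_right h2 (norm_nonneg z)
    nlinarith
  have := hanti (by simp) (by simp) (zero_le_one' ℝ)
  simp only [hh, one_smul, zero_smul, add_zero] at this
  linarith

end Single

/-- The standing assumptions on the summands: strong convexity and Lipschitz gradients. -/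
structure IsSmoothStrong {p n : ℕ} (f : Fin n → Eucl p → ℝ) (σ L : Fin n → ℝ) : Prop where
  pos : ∀ i, 0 < σ i
  conv : ∀ i, StrongConvexOn Set.univ (σ i) (f i)
  diff : ∀ i, Differentiable ℝ (f i)
  lip : ∀ i x y, ‖gradient (f i) x - gradient (f i) y‖ ≤ L i * ‖x - y‖

/-- The deviation of the empirical distribution of a sample from the uniform distribution. -/
def sampleDev {n : ℕ} (m : ℕ) (s : ℕ → Fin n) : ℝ :=
  ∑ j, |(((Finset.range m).filter fun i => s i = j).card : ℝ) / m - 1 / n|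

lemma sampleDev_nonneg {n m : ℕ} (s : ℕ → Fin n) : 0 ≤ sampleDev m s :=
  Finset.sum_nonneg fun _ _ => abs_nonneg _

variable {p n : ℕ} {f : Fin n → Eucl p → ℝ} {σ L : Fin n → ℝ}

/-- Compare the quadratic lower and upper bounds at two distinct points. This also yields L i > 0,
which is not assumed. -/
lemma IsSmoothStrong.const_le (H : IsSmoothStrong f σ L) {x y : Eucl p} (hxy : x ≠ y)
    (i : Fin n) : σ i ≤ L i := by
  have h1 := strongConvex_gradient_le (H.conv i) (H.diff i) x y
  have h2 := le_of_lipschitz_gradient (H.diff i) (H.lip i) x (y - x)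
  rw [add_sub_cancel] at h2
  have h3 : 0 < ‖y - x‖ ^ 2 := by
    have := norm_pos_iff.2 (sub_ne_zero.2 hxy.symm)
    positivity
  by_contra hlt
  nlinarith

lemma ciInf_le_apply (σ : Fin n → ℝ) (i : Fin n) : ⨅ i, σ i ≤ σ i :=
  ciInf_le (Set.finite_range σ).bddBelow i

lemma apply_le_ciSup (L : Fin n → ℝ) (i : Fin n) : L i ≤ ⨆ i, L i :=
  le_ciSup (Set.finite_range L).bddAbove i

lemma IsSmoothStrong.ciInf_pos (H : IsSmoothStrong f σ L) (hn : 0 < n) : 0 < ⨅ i, σ i := by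
  have : Nonempty (Fin n) := ⟨⟨0, hn⟩⟩
  obtain ⟨i, hi⟩ := exists_eq_ciInf_of_finite (f := σ)
  rw [← hi]
  exact H.pos i

lemma IsSmoothStrong.ciInf_le_ciSup (H : IsSmoothStrong f σ L) (hn : 0 < n) {x y : Eucl p}
    (hxy : x ≠ y) : ⨅ i, σ i ≤ ⨆ i, L i :=
  (ciInf_le_apply σ ⟨0, hn⟩).trans ((H.const_le hxy _).trans (apply_le_ciSup L _))

section Sample

variable {m : ℕ} {s : ℕ → Fin n}

lemma average_le_average {a b : ℕ → ℝ} (h : ∀ i, a i ≤ b i) :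
    1 / (m : ℝ) * ∑ i ∈ Finset.range m, a i ≤ 1 / (m : ℝ) * ∑ i ∈ Finset.range m, b i :=
  mul_le_mul_of_nonneg_left (Finset.sum_le_sum fun i _ => h i) (by positivity)

lemma average_const (hm : 0 < m) (c : ℝ) :
    1 / (m : ℝ) * ∑ _i ∈ Finset.range m, c = c := by
  have : (m : ℝ) ≠ 0 := by exact_mod_cast hm.ne'
  rw [Finset.sum_const, Finset.card_range, nsmul_eq_mul]
  field_simp

lemma inner_stochGrad (x z : Eucl p) : inner ℝ (stochGrad f m s x) z =
    1 / (m : ℝ) * ∑ i ∈ Finset.range m, inner ℝ (gradient (f (s i)) x) z := by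
  rw [stochGrad, real_inner_smul_left, sum_inner]

lemma IsSmoothStrong.sampled_gradient_le (H : IsSmoothStrong f σ L) (hm : 0 < m)
    (x y : Eucl p) : sampledObjective f m s x + inner ℝ (stochGrad f m s x) (y - x) +
      (⨅ i, σ i) / 2 * ‖y - x‖ ^ 2 ≤ sampledObjective f m s y := by
  rw [sampledObjective, inner_stochGrad, sampledObjective,
    ← average_const hm ((⨅ i, σ i) / 2 * ‖y - x‖ ^ 2), ← mul_add, ← mul_add,
    ← Finset.sum_add_distrib, ← Finset.sum_add_distrib]
  refine average_le_average fun i => ?_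
  have h1 := strongConvex_gradient_le (H.conv (s i)) (H.diff (s i)) x y
  have h2 : (⨅ i, σ i) / 2 * ‖y - x‖ ^ 2 ≤ σ (s i) / 2 * ‖y - x‖ ^ 2 := by
    gcongr
    exact ciInf_le_apply σ _
  linarith

lemma IsSmoothStrong.sampled_descent (H : IsSmoothStrong f σ L) (x z : Eucl p) :
    sampledObjective f m s (x + z) ≤ sampledObjective f m s x +
      inner ℝ (stochGrad f m s x) z + sampledLip L m s / 2 * ‖z‖ ^ 2 := by
  rw [sampledObjective, inner_stochGrad, sampledObjective, sampledLip, mul_div_assoc, mul_assoc,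
    Finset.sum_div, Finset.sum_mul, ← mul_add, ← mul_add,
    ← Finset.sum_add_distrib, ← Finset.sum_add_distrib]
  exact average_le_average fun i => le_of_lipschitz_gradient (H.diff (s i)) (H.lip (s i)) x z

/-- Controls the slope further along the direction; needed to see that exact line search does not
stop before the maximal step. -/
lemma IsSmoothStrong.inner_stochGrad_add_le (H : IsSmoothStrong f σ L) (x z : Eucl p) {t : ℝ}
    (ht : 0 ≤ t) : inner ℝ (stochGrad f m s (x + t • z)) z ≤
      inner ℝ (stochGrad f m s x) z + sampledLip L m s * (t * ‖z‖ ^ 2) := by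
  rw [inner_stochGrad, inner_stochGrad, sampledLip, mul_assoc, Finset.sum_mul, ← mul_add,
    ← Finset.sum_add_distrib]
  refine average_le_average fun i => ?_
  have h1 := real_inner_le_norm (gradient (f (s i)) (x + t • z) - gradient (f (s i)) x) z
  have h2 := H.lip (s i) (x + t • z) x
  rw [add_sub_cancel_left, norm_smul, Real.norm_of_nonneg ht] at h2
  have h3 := mul_le_mul_of_nonneg_right h2 (norm_nonneg z)
  rw [inner_sub_left] at h1
  nlinarith

lemma IsSmoothStrong.sampledLip_pos (H : IsSmoothStrong f σ L) (hm : 0 < m) {x y : Eucl p}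
    (hxy : x ≠ y) : 0 < sampledLip L m s := by
  have hm' : (0 : ℝ) < m := by exact_mod_cast hm
  refine mul_pos (by positivity) (Finset.sum_pos (fun i _ => ?_) ⟨0, by simpa using hm⟩)
  exact (H.pos _).trans_le (H.const_le hxy _)

lemma sampledLip_le (L : Fin n → ℝ) (hm : 0 < m) : sampledLip L m s ≤ ⨆ i, L i := by
  rw [sampledLip, ← average_const hm (⨆ i, L i)]
  exact average_le_average fun i => apply_le_ciSup L _

/-- Grouping the sample by index shows that the sampled objective depends on it only through
empirical frequencies. -/
lemma sampledObjective_sub_objective (y : Eucl p) :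
    sampledObjective f m s y - objective f y =
      ∑ j, ((((Finset.range m).filter fun i => s i = j).card : ℝ) / m - 1 / n) * f j y := by
  have h : ∑ i ∈ Finset.range m, f (s i) y =
      ∑ j, (((Finset.range m).filter fun i => s i = j).card : ℝ) * f j y := by
    rw [← Finset.sum_fiberwise (Finset.range m) s]
    refine Finset.sum_congr rfl fun j _ => ?_
    rw [Finset.sum_congr rfl (g := fun _ => f j y) fun i hi => by
      rw [(Finset.mem_filter.1 hi).2], Finset.sum_const, nsmul_eq_mul]
  rw [sampledObjective, objective, h, Finset.mul_sum, Finset.mul_sum, ← Finset.sum_sub_distrib]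
  refine Finset.sum_congr rfl fun j _ => ?_
  ring

/-- The sampled objective minus the objective is Lipschitz, with a constant proportional to the
deviation of the sample. -/
lemma abs_sampled_sub_objective_sub_le {G : ℝ} {x y : Eucl p}
    (hG : ∀ j, |f j x - f j y| ≤ G * ‖x - y‖) :
    |(sampledObjective f m s x - objective f x) - (sampledObjective f m s y - objective f y)| ≤
      G * sampleDev m s * ‖x - y‖ := by
  rw [sampledObjective_sub_objective, sampledObjective_sub_objective,
    ← Finset.sum_sub_distrib]
  simp only [← mul_sub]
  refine (Finset.abs_sum_le_sum_abs _ _).trans ?_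
  rw [sampleDev, mul_right_comm, mul_comm, Finset.sum_mul]
  refine Finset.sum_le_sum fun j _ => ?_
  rw [abs_mul]
  exact mul_le_mul_of_nonneg_left (hG j) (abs_nonneg _)

end Sample

/-- The summands are Lipschitz on bounded sets. -/
lemma IsSmoothStrong.exists_lipschitz (H : IsSmoothStrong f σ L) {S : Set (Eucl p)}
    (hS : Bornology.IsBounded S) :
    ∃ G, 0 ≤ G ∧ ∀ j, ∀ x ∈ S, ∀ y ∈ S, |f j x - f j y| ≤ G * ‖x - y‖ := by
  obtain ⟨R, hR⟩ := hS.exists_norm_le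
  have hb : ∀ j, ∀ x ∈ S, ‖gradient (f j) x‖ ≤ ‖gradient (f j) 0‖ + |L j| * |R| := by
    intro j x hx
    have h1 := H.lip j x 0
    rw [sub_zero] at h1
    have h2 : L j * ‖x‖ ≤ |L j| * |R| :=
      mul_le_mul (le_abs_self _) ((hR x hx).trans (le_abs_self _)) (norm_nonneg _) (abs_nonneg _)
    have h3 := norm_sub_norm_le (gradient (f j) x) (gradient (f j) 0)
    linarith
  have hb' : ∀ j, ∀ x ∈ S, ‖gradient (f j) x‖ ≤ ∑ i, (‖gradient (f i) 0‖ + |L i| * |R|) :=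
    fun j x hx => (hb j x hx).trans (Finset.single_le_sum
      (f := fun i => ‖gradient (f i) 0‖ + |L i| * |R|) (fun i _ => by positivity)
      (Finset.mem_univ j))
  have key : ∀ j, ∀ x ∈ S, ∀ y ∈ S, f j x - f j y ≤
      (∑ i, (‖gradient (f i) 0‖ + |L i| * |R|)) * ‖x - y‖ := by
    intro j x hx y _
    have h1 := strongConvex_gradient_le (H.conv j) (H.diff j) x y
    have h2 : 0 ≤ σ j / 2 * ‖y - x‖ ^ 2 := by have := H.pos j; positivity
    have h3 := real_inner_le_norm (gradient (f j) x) (x - y)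
    have h4 := mul_le_mul_of_nonneg_right (hb' j x hx) (norm_nonneg (x - y))
    rw [← neg_sub x y, inner_neg_right] at h1
    rw [← neg_sub x y] at h2
    linarith
  refine ⟨∑ i, (‖gradient (f i) 0‖ + |L i| * |R|), by positivity, fun j x hx y hy => ?_⟩
  rw [abs_le]
  have h1 := key j x hx y hy
  have h2 := key j y hy x hx
  rw [norm_sub_rev] at h2
  exact ⟨by linarith, h1⟩

lemma IsSmoothStrong.continuous_objective (H : IsSmoothStrong f σ L) :
    Continuous (objective f) := by
  unfold objective
  have := fun i => (H.diff i).continuous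
  fun_prop

lemma IsSmoothStrong.exists_minimizer (H : IsSmoothStrong f σ L) {r : ℕ} {C : Fin r → Eucl p}
    {d : Fin r → ℝ} (hbdd : Bornology.IsBounded (polyhedron C d))
    (hne : (polyhedron C d).Nonempty) :
    ∃ y ∈ polyhedron C d, objective f y = optValue C d f ∧
      ∀ z ∈ polyhedron C d, optValue C d f ≤ objective f z := by
  obtain ⟨y, hy, hmin⟩ := (isCompact_polyhedron hbdd).exists_isMinOn hne
    H.continuous_objective.continuousOn
  have heq : objective f y = optValue C d f := by
    have hleast : IsLeast (objective f '' polyhedron C d) (objective f y) := by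
      refine ⟨⟨y, hy, rfl⟩, ?_⟩
      rintro _ ⟨z, hz, rfl⟩
      exact hmin hz
    exact hleast.csInf_eq.symm
  exact ⟨y, hy, heq, fun z hz => heq ▸ hmin hz⟩

end Functions

/-! ### Vertex representations and the progress of one iteration. -/

noncomputable section Step

/-- `μ` represents `x` as a convex combination of at most `N` vertices. -/
structure IsRepresentation {p r : ℕ} (C : Fin r → Eucl p) (d : Fin r → ℝ) (N : ℕ)
    (μ : Eucl p →₀ ℝ) (x : Eucl p) : Prop where
  support_subset : ∀ v ∈ μ.support, v ∈ vertices C d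
  nonneg : ∀ v, 0 ≤ μ v
  sum_eq : (μ.sum fun _ a => a) = 1
  value_eq : (μ.sum fun v a => a • v) = x
  card_le : μ.support.card ≤ N

section MoveMass

variable {p : ℕ} {μ : Eucl p →₀ ℝ} {v u : Eucl p} {γ : ℝ}

lemma moveMass_apply (w : Eucl p) : moveMass μ v u γ w =
    μ w + Finsupp.single v γ w - Finsupp.single u γ w := rfl

lemma moveMass_nonneg (hμ : ∀ w, 0 ≤ μ w) (h0 : 0 ≤ γ) (h1 : γ ≤ μ u) (w : Eucl p) :
    0 ≤ moveMass μ v u γ w := by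
  classical
  rw [moveMass_apply, Finsupp.single_apply, Finsupp.single_apply]
  have := hμ w
  split_ifs with h2 h3 h3
  · linarith
  · linarith
  · subst h3; linarith
  · linarith

lemma moveMass_support_subset [DecidableEq (Eucl p)] (hu : u ∈ μ.support) :
    (moveMass μ v u γ).support ⊆ insert v μ.support := by
  intro w hw
  by_contra hcon
  rw [Finset.mem_insert, not_or] at hcon
  have hwu : u ≠ w := fun h => hcon.2 (h ▸ hu)
  rw [Finsupp.mem_support_iff, moveMass_apply, Finsupp.single_eq_of_ne hcon.1,
    Finsupp.single_eq_of_ne hwu.symm, Finsupp.notMem_support_iff.1 hcon.2] at hw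
  simp at hw

lemma moveMass_sum : ((moveMass μ v u γ).sum fun _ a => a) = μ.sum fun _ a => a := by
  classical
  rw [moveMass, Finsupp.sum_sub_index (by simp), Finsupp.sum_add_index' (by simp) (by simp),
    Finsupp.sum_single_index rfl, Finsupp.sum_single_index rfl]
  ring

lemma moveMass_value : ((moveMass μ v u γ).sum fun w a => a • w) =
    (μ.sum fun w a => a • w) + γ • (v - u) := by
  classical
  rw [moveMass, Finsupp.sum_sub_index (fun w a b => sub_smul a b w),
    Finsupp.sum_add_index' (by simp) (fun w a b => add_smul a b w),
    Finsupp.sum_single_index (zero_smul ℝ v), Finsupp.sum_single_index (zero_smul ℝ u)]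
  module

end MoveMass

section Representation

variable {p r : ℕ} {C : Fin r → Eucl p} {d : Fin r → ℝ} {N : ℕ} {μ ν : Eucl p →₀ ℝ}
  {x v u : Eucl p} {γ : ℝ}

lemma IsRepresentation.mem_polyhedron (h : IsRepresentation C d N μ x) :
    x ∈ polyhedron C d := by
  rw [← h.value_eq]
  exact convex_polyhedron.sum_mem (fun v _ => h.nonneg v) h.sum_eq
    fun v hv => vertices_subset (h.support_subset v hv)

lemma card_le_ncard_vertices {U : Finset (Eucl p)} (hU : ∀ v ∈ U, v ∈ vertices C d) :
    U.card ≤ (vertices C d).ncard := by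
  rw [← Set.ncard_coe_finset]
  exact Set.ncard_le_ncard hU finite_vertices

lemma IsRepresentation.update {var : Variant} (h : IsRepresentation C d N μ x)
    (hv : v ∈ vertices C d) (hu : u ∈ μ.support) (h0 : 0 ≤ γ) (h1 : γ ≤ μ u)
    (hup : IsUpdate (moveMass μ v u γ) ν var) :
    IsRepresentation C d (repSize C d var) ν (x + γ • (v - u)) := by
  classical
  have hsub : ∀ w ∈ (moveMass μ v u γ).support, w ∈ vertices C d := by
    intro w hw
    rcases Finset.mem_insert.1 (moveMass_support_subset hu hw) with rfl | hw'
    · exact hv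
    · exact h.support_subset w hw'
  have hval : ((moveMass μ v u γ).sum fun w a => a • w) = x + γ • (v - u) := by
    rw [moveMass_value, h.value_eq]
  cases var with
  | plain =>
    change ν = _ at hup
    subst hup
    exact ⟨hsub, moveMass_nonneg h.nonneg h0 h1, moveMass_sum.trans h.sum_eq, hval,
      card_le_ncard_vertices hsub⟩
  | caratheodory =>
    obtain ⟨hn, hs, hval', hc, hor⟩ := hup
    refine ⟨fun w hw => hsub w ?_, hn, hs, hval'.trans hval, hc⟩
    rcases hor with rfl | hss
    · exact hw
    · exact hss.subset hw

lemma IsRepresentation.inner_value_le (h : IsRepresentation C d N μ x) {g : Eucl p}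
    (hmax : ∀ y ∈ μ.support, inner ℝ g y ≤ inner ℝ g u) : inner ℝ g x ≤ inner ℝ g u := by
  have hs : ∑ y ∈ μ.support, μ y = 1 := h.sum_eq
  rw [← h.value_eq, Finsupp.sum, inner_sum]
  calc ∑ y ∈ μ.support, inner ℝ g (μ y • y) ≤ ∑ y ∈ μ.support, μ y * inner ℝ g u := by
        refine Finset.sum_le_sum fun y hy => ?_
        rw [inner_smul_right]
        exact mul_le_mul_of_nonneg_left (hmax y hy) (h.nonneg y)
    _ = inner ℝ g u := by rw [← Finset.sum_mul, hs, one_mul]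

end Representation

variable {p n : ℕ} {f : Fin n → Eucl p → ℝ} {σ L : Fin n → ℝ}

/-- Either the step is as good as the unconstrained minimizer of the quadratic upper model, or it is
the maximal one. -/
lemma IsSmoothStrong.step_cases (H : IsSmoothStrong f σ L) {m : ℕ} {s : ℕ → Fin n}
    (hℓ : 0 < sampledLip L m s) {x e : Eucl p} {γmax γ : ℝ} (hmax : 0 ≤ γmax)
    (he : inner ℝ (stochGrad f m s x) e ≤ 0)
    (hstep : IsStepSize (sampledObjective f m s) (stochGrad f m s x) (sampledLip L m s) x e
      γmax γ) :
    γ ∈ Set.Icc 0 γmax ∧ sampledObjective f m s (x + γ • e) ≤ sampledObjective f m s x ∧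
      ((inner ℝ (stochGrad f m s x) e) ^ 2 ≤ (sampledObjective f m s x -
          sampledObjective f m s (x + γ • e)) * (2 * sampledLip L m s * ‖e‖ ^ 2) ∨
        (γ = γmax ∧ e ≠ 0 ∧ γ * (-inner ℝ (stochGrad f m s x) e) / 2 ≤
          sampledObjective f m s x - sampledObjective f m s (x + γ • e))) := by
  set S := sampledObjective f m s with hS
  set ℓ := sampledLip L m s with hℓdef
  set b := -inner ℝ (stochGrad f m s x) e with hb
  have hb0 : 0 ≤ b := by rw [hb]; linarith
  have hbe : inner ℝ (stochGrad f m s x) e = -b := by rw [hb, neg_neg]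
  -- For e = 0 the quotient in the explicit rule is 0 / 0 = 0, so γ = 0.
  rcases eq_or_ne e 0 with rfl | he0
  · refine ⟨?_, by simp, Or.inl (by simp)⟩
    rcases hstep with h | h
    · rw [h]; simpa using hmax
    · exact h.1
  have hQ : 0 < ℓ * ‖e‖ ^ 2 := by
    have := norm_pos_iff.2 he0
    positivity
  set Q := ℓ * ‖e‖ ^ 2 with hQdef
  have hdesc : ∀ t : ℝ, S (x + t • e) ≤ S x - t * b + t ^ 2 * Q / 2 := by
    intro t
    have := H.sampled_descent (m := m) (s := s) x (t • e)
    rw [inner_smul_right, norm_smul, mul_pow, Real.norm_eq_abs, sq_abs, hbe] at this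
    rw [hQdef]
    linarith
  -- The minimizer of the quadratic upper model along e.
  set t₀ := b / Q with ht₀
  have ht₀Q : t₀ * Q = b := div_mul_cancel₀ _ hQ.ne'
  have ht₀0 : 0 ≤ t₀ := div_nonneg hb0 hQ.le
  rcases le_or_gt t₀ γmax with hgood | hbad
  · have hS₀ : S (x + t₀ • e) ≤ S x - t₀ * b / 2 := by
      have h1 := hdesc t₀
      have h2 : t₀ ^ 2 * Q = t₀ * b := by rw [sq, mul_assoc, ht₀Q]
      linarith
    have hγ : γ ∈ Set.Icc 0 γmax ∧ S (x + γ • e) ≤ S (x + t₀ • e) := by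
      rcases hstep with h | h
      · rw [min_eq_left hgood] at h
        rw [h]
        exact ⟨⟨ht₀0, hgood⟩, le_rfl⟩
      · exact ⟨h.1, h.2 ⟨ht₀0, hgood⟩⟩
    have h3 : 0 ≤ t₀ * b := mul_nonneg ht₀0 hb0
    refine ⟨hγ.1, by linarith [hγ.2], Or.inl ?_⟩
    rw [hbe, neg_sq]
    have h4 : b ^ 2 = t₀ * b / 2 * (2 * Q) := by
      rw [← ht₀Q]; ring
    rw [h4, mul_assoc 2 ℓ]
    exact mul_le_mul_of_nonneg_right (by linarith [hγ.2]) (by positivity)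
  · have hbQ : γmax * Q < b := by
      rw [← ht₀Q]
      exact mul_lt_mul_of_pos_right hbad hQ
    have hγ : γ = γmax := by
      rcases hstep with h | ⟨hmem, hmin⟩
      · rw [h]; exact min_eq_right hbad.le
      -- Line search stopping at γ < γmax would see a slope of at most -b + γ Q there. As γmax Q <
      -- b, the descent lemma from γ to γmax gives a strictly smaller value.
      · by_contra hne
        have hlt : γ < γmax := lt_of_le_of_ne hmem.2 hne
        have h1 : S (x + γ • e) ≤ S (x + γmax • e) := hmin ⟨hmax, le_rfl⟩
        have h2 := H.sampled_descent (m := m) (s := s) (x + γ • e) ((γmax - γ) • e)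
        have h3 := H.inner_stochGrad_add_le (m := m) (s := s) x e hmem.1
        have h4 : x + γ • e + (γmax - γ) • e = x + γmax • e := by module
        rw [h4, inner_smul_right, norm_smul, mul_pow, Real.norm_eq_abs, sq_abs] at h2
        have h5 : 0 < γmax - γ := sub_pos.2 hlt
        rw [hbe] at h3
        have h6 := mul_le_mul_of_nonneg_left h3 h5.le
        have h7 : ℓ * (γ * ‖e‖ ^ 2) = γ * Q := by rw [hQdef]; ring
        have h8 : ℓ / 2 * ((γmax - γ) ^ 2 * ‖e‖ ^ 2) = (γmax - γ) * ((γmax - γ) * Q / 2) := by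
          rw [hQdef]; ring
        rw [← hℓdef, h7] at h6
        rw [← hℓdef, h8] at h2
        have h9 : (γmax - γ) * (-b + γ * Q + (γmax - γ) * Q / 2) < 0 := by
          refine mul_neg_of_pos_of_neg h5 ?_
          have : γ * Q < γmax * Q := mul_lt_mul_of_pos_right hlt hQ
          linarith
        linarith
    have hdec : γ * b / 2 ≤ S x - S (x + γ • e) := by
      have h1 := hdesc γ
      rw [hγ] at h1 ⊢
      have h2 := mul_le_mul_of_nonneg_left hbQ.le hmax
      have h3 : γmax ^ 2 * Q = γmax * (γmax * Q) := by ring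
      linarith
    have h0 : 0 ≤ γ * b / 2 := by rw [hγ]; positivity
    exact ⟨⟨hγ.symm ▸ hmax, hγ.le⟩, by linarith, Or.inr ⟨hγ, he0, hdec⟩⟩

/-- The effect of one iteration on the accuracy of the iterate, up to the deviation of the sample:
it contracts, or the step is maximal and strictly decreases the objective. -/
lemma IsSmoothStrong.progress (H : IsSmoothStrong f σ L) (hn : 0 < n) {r : ℕ}
    {C : Fin r → Eucl p} {d : Fin r → ℝ} (hbdd : Bornology.IsBounded (polyhedron C d))
    (hnt : (polyhedron C d).Nontrivial) {N : ℕ} (hN : 0 < N) {G : ℝ} (hG0 : 0 ≤ G)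
    (hG : ∀ j, ∀ x ∈ polyhedron C d, ∀ y ∈ polyhedron C d, |f j x - f j y| ≤ G * ‖x - y‖)
    {c : ℝ} (hc0 : 0 ≤ c) (hc1 : c ≤ 1)
    (hc : c * (N ^ 2 * (⨆ i, L i) * Metric.diam (polyhedron C d) ^ 2) ≤
      vertexFacetConst C d ^ 2 * ⨅ i, σ i)
    {m : ℕ} (hm : 0 < m) {s : ℕ → Fin n} {x v u : Eucl p} {μ : Eucl p →₀ ℝ} {γ : ℝ}
    (hrep : IsRepresentation C d N μ x) (hv : v ∈ vertices C d)
    (hvmin : ∀ y ∈ polyhedron C d,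
      inner ℝ (stochGrad f m s x) v ≤ inner ℝ (stochGrad f m s x) y)
    (hu : u ∈ μ.support)
    (humax : ∀ y ∈ μ.support, inner ℝ (stochGrad f m s x) y ≤ inner ℝ (stochGrad f m s x) u)
    (hstep : IsStepSize (sampledObjective f m s) (stochGrad f m s x) (sampledLip L m s) x (v - u)
      (μ u) γ) (hx' : x + γ • (v - u) ∈ polyhedron C d) :
    let D := Metric.diam (polyhedron C d)
    let A := 3 * (G * D) + 2 * (G * D) * (N * D / vertexFacetConst C d)
    let gap := fun z => objective f z - optValue C d f
    γ ∈ Set.Icc 0 (μ u) ∧ gap (x + γ • (v - u)) ≤ gap x + A * sampleDev m s ∧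
      (gap (x + γ • (v - u)) ≤ (1 - c) * gap x + A * sampleDev m s ∨
        (γ = μ u ∧ v ≠ u ∧ gap (x + γ • (v - u)) < gap x)) := by
  intro D A gap
  obtain ⟨a, ha, b, hb, hab⟩ := id hnt
  have hℓ : 0 < sampledLip L m s := H.sampledLip_pos hm hab
  have hxP := hrep.mem_polyhedron
  have huV := hrep.support_subset u hu
  have huP := vertices_subset huV
  have hvP := vertices_subset hv
  obtain ⟨y, hy, hyF, hopt⟩ := H.exists_minimizer hbdd hnt.nonempty
  set g := stochGrad f m s x with hg
  have hvu : inner ℝ g (v - u) ≤ 0 := by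
    rw [inner_sub_right]
    linarith [hvmin u huP]
  have hμu : 0 < μ u :=
    lt_of_le_of_ne (hrep.nonneg u) (Finsupp.mem_support_iff.1 hu).symm
  obtain ⟨hγ, hmono, hcase⟩ := H.step_cases hℓ hμu.le hvu hstep
  set x' := x + γ • (v - u) with hx'def
  set S := sampledObjective f m s with hS
  set δ := sampleDev m s with hδ
  have hδ0 : 0 ≤ δ := sampleDev_nonneg s
  have hD : 0 < D := diam_polyhedron_pos hbdd hnt
  have hΩ : 0 < vertexFacetConst C d := vertexFacetConst_pos hbdd hnt
  set Ω := vertexFacetConst C d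
  have hN' : (0 : ℝ) < N := by exact_mod_cast hN
  have hdev : ∀ z ∈ polyhedron C d, ∀ w ∈ polyhedron C d,
      |(S z - objective f z) - (S w - objective f w)| ≤ G * δ * ‖z - w‖ := fun z hz w hw =>
    abs_sampled_sub_objective_sub_le fun j => hG j z hz w hw
  have hdevD : ∀ z ∈ polyhedron C d, ∀ w ∈ polyhedron C d,
      |(S z - objective f z) - (S w - objective f w)| ≤ G * D * δ := fun z hz w hw => by
    refine (hdev z hz w hw).trans ?_
    rw [mul_right_comm]
    exact mul_le_mul_of_nonneg_right
      (mul_le_mul_of_nonneg_left (norm_sub_le_diam hbdd hz hw) hG0) hδ0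
  have hGDδ : 0 ≤ G * D * δ := by positivity
  have hextra : 0 ≤ 2 * (G * D) * (N * D / Ω) * δ := by positivity
  have hA : A * δ = 3 * (G * D * δ) + 2 * (G * D) * (N * D / Ω) * δ := by
    simp only [A]; ring
  have hgap : 0 ≤ gap x := sub_nonneg.2 (hopt x hxP)
  have h1 := abs_le.1 (hdevD x' hx' x hxP)
  have hplus : gap x' ≤ gap x + G * D * δ := by
    simp only [gap]; linarith
  have hfacet := vertexFacetConst_mul_inner_le hbdd hnt hrep.support_subset
    (fun v _ => hrep.nonneg v) hrep.sum_eq hrep.value_eq hy humax hvmin hrep.card_le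
  have hgu : inner ℝ g u - inner ℝ g v = -inner ℝ g (v - u) := by
    rw [inner_sub_right]; ring
  rw [hgu] at hfacet
  set β := -inner ℝ g (v - u) with hβ
  have hβ0 : 0 ≤ β := by rw [hβ]; linarith
  have hstrong : S x - S y ≤ inner ℝ g (x - y) - (⨅ i, σ i) / 2 * ‖x - y‖ ^ 2 := by
    have := H.sampled_gradient_le (s := s) hm x y
    rw [← neg_sub x y, inner_neg_right, norm_neg] at this
    linarith
  have hσ := H.ciInf_pos hn
  have hLF : 0 < ⨆ i, L i := hσ.trans_le (H.ciInf_le_ciSup hn hab)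
  refine ⟨hγ, by rw [hA]; linarith, ?_⟩
  rcases hcase with hgood | ⟨hγmax, hne, hdec⟩
  · left
    have hdec0 : 0 ≤ S x - S x' := sub_nonneg.2 hmono
    have hcontr : c * (S x - S y) ≤ S x - S x' := by
      -- The difference can be negative, since y minimizes the true objective and not the sampled
      -- one.
      rcases le_or_gt (S x - S y) 0 with h | h
      · exact (mul_nonpos_of_nonneg_of_nonpos hc0 h).trans hdec0
      set W := N ^ 2 * (⨆ i, L i) * D ^ 2 with hW
      have hWpos : 0 < W := by positivity
      set τ := ⨅ i, σ i
      have e1 : (Ω ^ 2 * τ) * (S x - S y) ≤ N ^ 2 * β ^ 2 / 2 := by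
        have i1 := mul_le_mul_of_nonneg_left hstrong (by positivity : 0 ≤ Ω ^ 2 * τ)
        have i2 := mul_le_mul_of_nonneg_left hfacet (by positivity : 0 ≤ Ω * τ)
        -- Completing the square eliminates the unknown distance ‖x - y‖.
        nlinarith [sq_nonneg (N * β - Ω * τ * ‖x - y‖)]
      have e2 : β ^ 2 ≤ (S x - S x') * (2 * (⨆ i, L i) * D ^ 2) := by
        rw [hβ, neg_sq]
        refine hgood.trans (mul_le_mul_of_nonneg_left ?_ hdec0)
        have j1 : ‖v - u‖ ≤ D := norm_sub_le_diam hbdd hvP huP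
        have j2 : sampledLip L m s ≤ ⨆ i, L i := sampledLip_le L hm
        gcongr
      have e3 : W * (c * (S x - S y)) ≤ W * (S x - S x') := by
        have i1 := mul_le_mul_of_nonneg_right hc h.le
        have i2 := mul_le_mul_of_nonneg_left e2 (by positivity : 0 ≤ (N : ℝ) ^ 2 / 2)
        rw [hW]
        rw [hW] at i1
        linarith
      exact le_of_mul_le_mul_left e3 hWpos
    have h2 := abs_le.1 (hdevD x' hx' y hy)
    have h3 := abs_le.1 (hdevD x hxP y hy)
    have h4 : (1 - c) * (S x - S y) ≤ (1 - c) * (gap x + G * D * δ) := by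
      refine mul_le_mul_of_nonneg_left ?_ (by linarith)
      simp only [gap]; linarith
    have h5 : 0 ≤ c * (G * D * δ) := by positivity
    have h6 : gap x' ≤ (S x' - S y) + G * D * δ := by
      simp only [gap]; linarith
    rw [hA]
    linarith
  -- The threshold beyond which the pairwise gap β exceeds 2GDδ. Below it the error term A δ alone
  -- pays for the contraction estimate.
  · set A₀ := G * D + 2 * (G * D) * (N * D / Ω) with hA₀
    rcases le_or_gt (gap x) (A₀ * δ) with hsmall | hlarge
    · left
      have h2 : 0 ≤ (1 - c) * gap x := mul_nonneg (by linarith) hgap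
      rw [hA]
      have h3 : A₀ * δ = G * D * δ + 2 * (G * D) * (N * D / Ω) * δ := by rw [hA₀]; ring
      linarith
    · right
      refine ⟨hγmax, sub_ne_zero.1 hne, ?_⟩
      have hγ0 : 0 < γ := hγmax ▸ hμu
      have h2 := abs_le.1 (hdevD x hxP y hy)
      have h3 : gap x - G * D * δ ≤ inner ℝ g (x - y) := by
        have : 0 ≤ (⨅ i, σ i) / 2 * ‖x - y‖ ^ 2 := by positivity
        simp only [gap]; linarith
      have h4 : 2 * (G * D) * (N * D / Ω) * δ < inner ℝ g (x - y) := by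
        have : A₀ * δ = G * D * δ + 2 * (G * D) * (N * D / Ω) * δ := by rw [hA₀]; ring
        linarith
      have h5 : 2 * (G * D) * δ * (N * D) < β * (N * D) := by
        calc 2 * (G * D) * δ * (N * D) = Ω * (2 * (G * D) * (N * D / Ω) * δ) := by
              field_simp
          _ < Ω * inner ℝ g (x - y) := mul_lt_mul_of_pos_left h4 hΩ
          _ ≤ N * ‖x - y‖ * β := hfacet
          _ ≤ N * D * β := by
              have := norm_sub_le_diam hbdd hxP hy
              gcongr
          _ = β * (N * D) := by ring
      have h6 : 2 * (G * D) * δ < β := lt_of_mul_lt_mul_right h5 (by positivity)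
      -- Here the error must scale with the step: it is at most G δ ‖x' - x‖ ≤ γ G D δ < γ β / 2,
      -- the guaranteed sampled decrease. The uniform bound `hdevD` would not suffice for short
      -- steps.
      have h7 := abs_le.1 (hdev x' hx' x hxP)
      have h8 : ‖x' - x‖ ≤ γ * D := by
        rw [hx'def, add_sub_cancel_left, norm_smul, Real.norm_of_nonneg hγ0.le]
        exact mul_le_mul_of_nonneg_left (norm_sub_le_diam hbdd hvP huP) hγ0.le
      have h9 : G * δ * ‖x' - x‖ ≤ G * δ * (γ * D) :=
        mul_le_mul_of_nonneg_left h8 (by positivity)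
      have h10 := mul_lt_mul_of_pos_left h6 hγ0
      simp only [gap]
      linarith

end Step

/-! ### Counting weight vectors reachable by maximal steps. -/

section Counting

variable {E : Type*}

lemma sum_descFactorial_succ (n : ℕ) :
    ∑ s ∈ Finset.range (n + 2), (n + 1).descFactorial s =
      1 + (n + 1) * ∑ s ∈ Finset.range (n + 1), n.descFactorial s := by
  rw [Finset.sum_range_succ', Nat.descFactorial_zero, add_comm, Finset.mul_sum]
  simp only [Nat.succ_descFactorial_succ]

/-- The sum is n! ∑ 1/j! < e n!. The induction along the recurrence only closes with the sharper `+
1`. -/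
lemma sum_descFactorial_le (n : ℕ) :
    ∑ s ∈ Finset.range (n + 1), n.descFactorial s ≤ 3 * n.factorial := by
  have key : ∀ n : ℕ, ∑ s ∈ Finset.range (n + 2), (n + 1).descFactorial s + 1 ≤
      3 * (n + 1).factorial := by
    intro n
    induction n with
    | zero => decide
    | succ n ih =>
      rw [sum_descFactorial_succ, Nat.factorial_succ (n + 1)]
      nlinarith
  cases n with
  | zero => decide
  | succ n => exact (Nat.le_succ _).trans (key n)

/-- The weights `μ` are the numbers `c`, placed at distinct points of `V`. -/
def IsArrangement {s : ℕ} (V : Finset E) (c : Fin s → ℝ) (μ : E →₀ ℝ) : Prop :=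
  ∃ e : Fin s ↪ V, μ = ∑ i, Finsupp.single (e i : E) (c i)

lemma exists_isArrangement {V : Finset E} {μ : E →₀ ℝ} (hμ : μ.support ⊆ V) {s : ℕ}
    (hs : μ.support.card = s) : ∃ c : Fin s → ℝ, (∀ i, c i ≠ 0) ∧ IsArrangement V c μ := by
  let e := (μ.support.equivFinOfCardEq hs).symm
  refine ⟨fun i => μ (e i), fun i => Finsupp.mem_support_iff.1 (e i).2,
    ⟨⟨fun i => ⟨e i, hμ (e i).2⟩, fun i j hij => ?_⟩, ?_⟩⟩
  · have : (e i : E) = e j := congrArg (fun w : V => (w : E)) hij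
    exact e.injective (Subtype.ext this)
  · change μ = ∑ i, Finsupp.single (e i : E) (μ (e i))
    rw [Equiv.sum_comp e fun w : μ.support => Finsupp.single (w : E) (μ w),
      Finset.sum_coe_sort μ.support fun w => Finsupp.single w (μ w)]
    exact (Finsupp.sum_single μ).symm

/-- The effect of a maximal step on the weights: the support shrinks, or the mass of an active
vertex moves to an inactive one. -/
def IsDropOrSwap (V : Finset E) (μ ν : E →₀ ℝ) : Prop :=
  ν.support.card < μ.support.card ∨ ∃ u ∈ μ.support, ∃ v ∈ V, v ∉ μ.support ∧
    ν = μ + Finsupp.single v (μ u) - Finsupp.single u (μ u)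

lemma arrangement_apply {s : ℕ} {V : Finset E} {c : Fin s → ℝ} (e : Fin s ↪ V) (i : Fin s) :
    (∑ j, Finsupp.single (e j : E) (c j)) (e i : E) = c i := by
  classical
  rw [Finsupp.finsetSum_apply, Finset.sum_eq_single i]
  · simp
  · intro j _ hji
    refine Finsupp.single_eq_of_ne fun h => hji ?_
    exact (e.injective (Subtype.ext h)).symm
  · simp

lemma arrangement_support {s : ℕ} {V : Finset E} {c : Fin s → ℝ} (e : Fin s ↪ V) {w : E}
    (hw : w ∈ (∑ j, Finsupp.single (e j : E) (c j)).support) : ∃ i, (e i : E) = w := by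
  classical
  by_contra hcon
  push Not at hcon
  rw [Finsupp.mem_support_iff, Finsupp.finsetSum_apply] at hw
  exact hw (Finset.sum_eq_zero fun j _ => Finsupp.single_eq_of_ne (hcon j).symm)

/-- Redirect the index placed at u to v. Since the numbers c are nonzero, an inactive v is not yet
occupied and injectivity persists. -/
lemma IsArrangement.swap {s : ℕ} {V : Finset E} {c : Fin s → ℝ} (hc : ∀ i, c i ≠ 0)
    {μ : E →₀ ℝ} (h : IsArrangement V c μ) {u v : E} (hu : u ∈ μ.support) (hvV : v ∈ V)
    (hv : v ∉ μ.support) :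
    IsArrangement V c (μ + Finsupp.single v (μ u) - Finsupp.single u (μ u)) := by
  classical
  obtain ⟨e, he⟩ := h
  rw [he] at hu
  obtain ⟨k, hk⟩ := arrangement_support e hu
  have hne : ∀ i, (e i : E) ≠ v := by
    rintro i rfl
    rw [he, Finsupp.mem_support_iff, arrangement_apply] at hv
    exact hv (hc i)
  have hμu : μ u = c k := by rw [he, ← hk, arrangement_apply]
  have hinj : Function.Injective (Function.update e k ⟨v, hvV⟩) := by
    intro i j hij
    have hne' : ∀ i, e i ≠ ⟨v, hvV⟩ := fun i h => hne i (congrArg Subtype.val h)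
    rcases eq_or_ne i k with rfl | hi <;> rcases eq_or_ne j i with rfl | hji
    · rfl
    · rw [Function.update_self, Function.update_of_ne hji] at hij
      exact (hne' j hij.symm).elim
    · rfl
    · rw [Function.update_of_ne hi] at hij
      rcases eq_or_ne j k with rfl | hj
      · rw [Function.update_self] at hij
        exact (hne' i hij).elim
      · rw [Function.update_of_ne hj] at hij
        exact e.injective hij
  refine ⟨⟨Function.update e k ⟨v, hvV⟩, hinj⟩, ?_⟩
  rw [hμu]
  have h1 : ∀ i, Finsupp.single ((Function.update e k ⟨v, hvV⟩ i : V) : E) (c i) =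
      Finsupp.single (e i : E) (c i) +
        if i = k then Finsupp.single v (c k) - Finsupp.single u (c k) else 0 := by
    intro i
    rcases eq_or_ne i k with rfl | hik
    · simp [hk]
    · simp [hik]
  change _ = ∑ i, Finsupp.single ((Function.update e k ⟨v, hvV⟩ i : V) : E) (c i)
  rw [Finset.sum_congr rfl fun i _ => h1 i, Finset.sum_add_distrib, ← he]
  simp [add_sub_assoc]

/-- There are at most `3 |V|!` consecutive weights without repetition that arise by maximal
steps. -/
lemma length_le_of_isDropOrSwap {V : Finset E} {μ : ℕ → E →₀ ℝ} {W : ℕ}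
    (hstep : ∀ j < W, IsDropOrSwap V (μ j) (μ (j + 1))) (hV : ∀ j ≤ W, (μ j).support ⊆ V)
    (hinj : Set.InjOn μ (Set.Iic W)) : W + 1 ≤ 3 * V.card.factorial := by
  classical
  have hcard : ∀ j < W, (μ (j + 1)).support.card ≤ (μ j).support.card := by
    intro j hj
    rcases hstep j hj with h | ⟨u, hu, v, hv, hvμ, h⟩
    · exact h.le
    · have hsub : (μ (j + 1)).support ⊆ insert v ((μ j).support.erase u) := by
        intro w hw
        rw [Finset.mem_insert, Finset.mem_erase]
        by_contra hcon
        push Not at hcon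
        have huv : u ≠ v := fun huv => hvμ (huv ▸ hu)
        rw [Finsupp.mem_support_iff, h, Finsupp.sub_apply, Finsupp.add_apply,
          Finsupp.single_eq_of_ne hcon.1] at hw
        rcases eq_or_ne w u with rfl | hwu
        · simp at hw
        · rw [Finsupp.single_eq_of_ne hwu, Finsupp.notMem_support_iff.1 (hcon.2 hwu)] at hw
          simp at hw
      refine (Finset.card_le_card hsub).trans ((Finset.card_insert_le _ _).trans ?_)
      rw [Finset.card_erase_add_one hu]
  have hanti : ∀ i j, i ≤ j → j ≤ W → (μ j).support.card ≤ (μ i).support.card := by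
    intro i j hij
    induction j, hij using Nat.le_induction with
    | base => intro _; exact le_rfl
    | succ j hij ih => intro hj; exact (hcard j (by omega)).trans (ih (by omega))
  set T : ℕ → Finset ℕ := fun s =>
    (Finset.range (W + 1)).filter fun j => (μ j).support.card = s with hT
  have hTcard : ∀ s, (T s).card ≤ V.card.descFactorial s := by
    intro s
    rcases (T s).eq_empty_or_nonempty with h | hne
    · simp [h]
    have hmem : ∀ j, j ∈ T s ↔ j ≤ W ∧ (μ j).support.card = s := fun j => by
      simp [hT]
    set k := (T s).min' hne
    have hk := (hmem k).1 ((T s).min'_mem hne)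
    obtain ⟨c, hc, harr⟩ := exists_isArrangement (hV k hk.1) hk.2
    -- Support sizes never increase, so the indices of size s are consecutive and joined by swaps
    -- only; all these weights are arrangements of the same numbers.
    have hall : ∀ j, k ≤ j → j ≤ W → (μ j).support.card = s → IsArrangement V c (μ j) := by
      intro j hkj
      induction j, hkj using Nat.le_induction with
      | base => intro _ _; exact harr
      | succ j hkj ih =>
        intro hjW hjs
        have hj : (μ j).support.card = s :=
          le_antisymm (hk.2 ▸ hanti k j hkj (by omega)) (hjs ▸ hcard j (by omega))
        rcases hstep j (by omega) with h | ⟨u, hu, v, hv, hvμ, h⟩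
        · omega
        · rw [h]
          exact (ih (by omega) hj).swap hc hu hv hvμ
    have hall' : ∀ j : T s, IsArrangement V c (μ j) := fun j =>
      hall j ((T s).min'_le _ j.2) ((hmem j).1 j.2).1 ((hmem j).1 j.2).2
    choose e he using hall'
    -- Distinct weights need distinct placements of c.
    have hle : Fintype.card (T s) ≤ Fintype.card (Fin s ↪ V) := by
      refine Fintype.card_le_of_injective e fun i j hij => Subtype.ext ?_
      refine hinj ((hmem i).1 i.2).1 ((hmem j).1 j.2).1 ?_
      rw [he i, he j, hij]
    simpa [Fintype.card_embedding_eq] using hle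
  have hsum : W + 1 = ∑ s ∈ Finset.range (V.card + 1), (T s).card := by
    rw [← Finset.card_eq_sum_card_fiberwise, Finset.card_range]
    intro j hj
    simp only [Finset.coe_range, Set.mem_Iio] at hj ⊢
    exact Nat.lt_succ_of_le (Finset.card_le_card (hV j (by omega)))
  rw [hsum]
  exact (Finset.sum_le_sum fun s _ => hTcard s).trans (sum_descFactorial_le _)

end Counting

/-! ### Maximal steps as drops or swaps. -/

section MaximalStep

variable {p r : ℕ} {C : Fin r → Eucl p} {d : Fin r → ℝ}

/-- Emptying u removes it, so the transfer never enlarges the support: it shrinks if v was active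
and is a swap if not. A Carathéodory reduction either changes nothing or strictly shrinks the
support further. -/
lemma isDropOrSwap_of_isUpdate {var : Variant} {μ ν : Eucl p →₀ ℝ} {v u : Eucl p}
    {V : Finset (Eucl p)} (hv : v ∈ V) (hu : u ∈ μ.support) (hvu : v ≠ u)
    (hup : IsUpdate (moveMass μ v u (μ u)) ν var) : IsDropOrSwap V μ ν := by
  classical
  have hsub : (moveMass μ v u (μ u)).support ⊆ insert v (μ.support.erase u) := by
    intro w hw
    rcases Finset.mem_insert.1 (moveMass_support_subset hu hw) with rfl | hw'
    · exact Finset.mem_insert_self _ _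
    · refine Finset.mem_insert_of_mem (Finset.mem_erase.2 ⟨?_, hw'⟩)
      rintro rfl
      rw [Finsupp.mem_support_iff, moveMass_apply, Finsupp.single_eq_of_ne hvu.symm] at hw
      simp at hw
  have hplain : IsDropOrSwap V μ (moveMass μ v u (μ u)) := by
    by_cases hvμ : v ∈ μ.support
    · left
      rw [Finset.insert_eq_self.2 (Finset.mem_erase.2 ⟨hvu, hvμ⟩)] at hsub
      exact (Finset.card_le_card hsub).trans_lt (Finset.card_erase_lt_of_mem hu)
    · exact Or.inr ⟨u, hu, v, hv, hvμ, rfl⟩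
  cases var with
  | plain =>
    change ν = _ at hup
    exact hup ▸ hplain
  | caratheodory =>
    rcases hup.2.2.2.2 with h | h
    · exact h ▸ hplain
    · left
      refine (Finset.card_lt_card h).trans_le ((Finset.card_le_card hsub).trans
        ((Finset.card_insert_le _ _).trans ?_))
      rw [Finset.card_erase_add_one hu]

end MaximalStep

/-! ### Contraction over a window of a sample path. -/

section Path

variable {p r n : ℕ} {C : Fin r → Eucl p} {d : Fin r → ℝ} {f : Fin n → Eucl p → ℝ}
  {σ L : Fin n → ℝ} {var : Variant} {m : ℕ → ℕ} {s : ℕ → ℕ → Fin n} {x : ℕ → Eucl p}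
  {μ : ℕ → Eucl p →₀ ℝ} {v u : ℕ → Eucl p} {γ : ℕ → ℝ}

lemma one_le_repSize (hne : (vertices C d).Nonempty) : 1 ≤ repSize C d var := by
  cases var with
  | plain => exact (Set.ncard_pos finite_vertices).2 hne
  | caratheodory => exact Nat.le_add_left 1 p

lemma IsRun.start_representation (R : IsRun C d f L var m s x μ v u γ) :
    IsRepresentation C d (repSize C d var) (μ 1) (x 1) := by
  have hne : (vertices C d).Nonempty := ⟨_, R.start_mem⟩
  rw [R.start_weights]
  refine ⟨fun w hw => ?_, fun w => ?_, by simp, by simp, ?_⟩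
  · rw [Finset.mem_singleton.1 (Finsupp.support_single_subset hw)]
    exact R.start_mem
  · classical
    rw [Finsupp.single_apply]
    split_ifs <;> norm_num
  · exact (Finset.card_le_card Finsupp.support_single_subset).trans (one_le_repSize hne)

/-- The properties of a single iteration of a run. -/
lemma IsRun.iteration (R : IsRun C d f L var m s x μ v u γ) (H : IsSmoothStrong f σ L)
    (hnt : (polyhedron C d).Nontrivial) (hm : ∀ k, 0 < m k) {k : ℕ} (hk : 1 ≤ k)
    (hrep : IsRepresentation C d (repSize C d var) (μ k) (x k)) :
    IsRepresentation C d (repSize C d var) (μ (k + 1)) (x (k + 1)) := by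
  obtain ⟨a, -, b, -, hab⟩ := hnt
  have hvu : inner ℝ (stochGrad f (m k) (s k) (x k)) (v k - u k) ≤ 0 := by
    rw [inner_sub_right]
    linarith [R.oracle_min k hk _ hrep.mem_polyhedron, hrep.inner_value_le (R.away_max k hk)]
  have hγ := (H.step_cases (H.sampledLip_pos (hm k) hab) (hrep.nonneg (u k)) hvu
    (R.step_size k hk)).1
  rw [R.step k hk]
  exact hrep.update (R.oracle_mem k hk) (R.away_mem k hk) hγ.1 hγ.2 (R.update k hk)

lemma IsRun.representation (R : IsRun C d f L var m s x μ v u γ) (H : IsSmoothStrong f σ L)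
    (hnt : (polyhedron C d).Nontrivial) (hm : ∀ k, 0 < m k) {k : ℕ} (hk : 1 ≤ k) :
    IsRepresentation C d (repSize C d var) (μ k) (x k) := by
  induction k, hk using Nat.le_induction with
  | base => exact R.start_representation
  | succ k hk ih => exact R.iteration H hnt hm hk ih

/-- In `3 |V|!` consecutive iterations the accuracy contracts at least once, up to the deviations
of the samples. -/
lemma IsRun.contraction_window (hn : 0 < n) (H : IsSmoothStrong f σ L)
    (hbdd : Bornology.IsBounded (polyhedron C d)) (hnt : (polyhedron C d).Nontrivial)
    {G : ℝ} (hG0 : 0 ≤ G)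
    (hG : ∀ j, ∀ x ∈ polyhedron C d, ∀ y ∈ polyhedron C d, |f j x - f j y| ≤ G * ‖x - y‖)
    {c : ℝ} (hc0 : 0 ≤ c) (hc1 : c ≤ 1)
    (hc : c * ((repSize C d var : ℝ) ^ 2 * (⨆ i, L i) * Metric.diam (polyhedron C d) ^ 2) ≤
      vertexFacetConst C d ^ 2 * ⨅ i, σ i) :
    ∃ A : ℝ, 0 ≤ A ∧ ∀ (m : ℕ → ℕ) (s : ℕ → ℕ → Fin n) (x : ℕ → Eucl p) (μ : ℕ → Eucl p →₀ ℝ)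
      (v u : ℕ → Eucl p) (γ : ℕ → ℝ), (∀ k, 0 < m k) → IsRun C d f L var m s x μ v u γ →
      ∀ k, 1 ≤ k →
        objective f (x (k + 3 * (vertices C d).ncard.factorial)) - optValue C d f ≤
          (1 - c) * (objective f (x k) - optValue C d f) +
            A * ∑ j ∈ Finset.Ico k (k + 3 * (vertices C d).ncard.factorial),
              sampleDev (m j) (s j) := by
  classical
  have hne := (nontrivial_vertices hbdd hnt).nonempty
  set D := Metric.diam (polyhedron C d) with hD
  set Ω := vertexFacetConst C d with hΩ
  have hDpos : 0 < D := diam_polyhedron_pos hbdd hnt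
  have hΩpos : 0 < Ω := vertexFacetConst_pos hbdd hnt
  refine ⟨3 * (G * D) + 2 * (G * D) * ((repSize C d var : ℝ) * D / Ω), by positivity, ?_⟩
  intro m s x μ v u γ hm R k hk
  set A := 3 * (G * D) + 2 * (G * D) * ((repSize C d var : ℝ) * D / Ω) with hA
  have hA0 : 0 ≤ A := by positivity
  set δ := fun j => sampleDev (m j) (s j) with hδ
  have hδ0 : ∀ j, 0 ≤ δ j := fun j => sampleDev_nonneg _
  set gap := fun j => objective f (x j) - optValue C d f with hgap
  set B := 3 * (vertices C d).ncard.factorial with hB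
  have hrep : ∀ j, 1 ≤ j → IsRepresentation C d (repSize C d var) (μ j) (x j) := fun j hj =>
    R.representation H hnt hm hj
  have hprog : ∀ j, 1 ≤ j → gap (j + 1) ≤ gap j + A * δ j ∧
      (gap (j + 1) ≤ (1 - c) * gap j + A * δ j ∨
        (γ j = μ j (u j) ∧ v j ≠ u j ∧ gap (j + 1) < gap j)) := by
    intro j hj
    have hx' : x j + γ j • (v j - u j) ∈ polyhedron C d := by
      rw [← R.step j hj]
      exact (hrep (j + 1) (by omega)).mem_polyhedron
    have := H.progress hn hbdd hnt (one_le_repSize hne) hG0 hG hc0 hc1 hc (hm j) (hrep j hj)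
      (R.oracle_mem j hj) (R.oracle_min j hj) (R.away_mem j hj) (R.away_max j hj)
      (R.step_size j hj) hx'
    rw [← R.step j hj] at this
    exact this.2
  have hchain : ∀ i l, 1 ≤ i → i ≤ l → gap l ≤ gap i + A * ∑ j ∈ Finset.Ico i l, δ j := by
    intro i l hi hil
    induction l, hil using Nat.le_induction with
    | base => simp
    | succ l hil ih =>
      rw [Finset.sum_Ico_succ_top hil, mul_add]
      linarith [(hprog l (hi.trans hil)).1]
  by_cases hex : ∃ j, k ≤ j ∧ j < k + B ∧ gap (j + 1) ≤ (1 - c) * gap j + A * δ j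
  · obtain ⟨j, hkj, hjB, hj⟩ := hex
    have h1 := hchain k j hk hkj
    have h2 := hchain (j + 1) (k + B) (by omega) (by omega)
    have h3 : ∑ i ∈ Finset.Ico k (k + B), δ i =
        ∑ i ∈ Finset.Ico k j, δ i + (δ j + ∑ i ∈ Finset.Ico (j + 1) (k + B), δ i) := by
      rw [← Finset.sum_eq_sum_Ico_succ_bot hjB,
        Finset.sum_Ico_consecutive _ hkj hjB.le]
    -- Errors before the contraction are damped by 1 - c; `h5` gives this gain away.
    have h4 := mul_le_mul_of_nonneg_left h1 (by linarith : 0 ≤ 1 - c)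
    have h5 : 0 ≤ c * (A * ∑ i ∈ Finset.Ico k j, δ i) :=
      mul_nonneg hc0 (mul_nonneg hA0 (Finset.sum_nonneg fun i _ => hδ0 i))
    change gap (k + B) ≤ (1 - c) * gap k + A * ∑ i ∈ Finset.Ico k (k + B), δ i
    rw [h3]
    linarith
  · exfalso
    push Not at hex
    have hbad : ∀ j, k ≤ j → j < k + B →
        γ j = μ j (u j) ∧ v j ≠ u j ∧ gap (j + 1) < gap j := fun j hkj hjB =>
      (hprog j (hk.trans hkj)).2.resolve_left (hex j hkj hjB).not_ge
    set V := (finite_vertices (C := C) (d := d)).toFinset with hV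
    have hVcard : V.card = (vertices C d).ncard := (Set.ncard_eq_toFinset_card _ _).symm
    have hdecr : ∀ i j, i < j → j ≤ B → gap (k + j) < gap (k + i) := by
      intro i j hij
      induction j, hij using Nat.le_induction with
      | base => intro hj; exact (hbad (k + i) (by omega) (by omega)).2.2
      | succ j hij ih =>
        intro hj
        exact (hbad (k + j) (by omega) (by omega)).2.2.trans (ih (by omega))
    have hval : ∀ i j, μ (k + i) = μ (k + j) → gap (k + i) = gap (k + j) := by
      intro i j hij
      have : x (k + i) = x (k + j) := by
        rw [← (hrep (k + i) (by omega)).value_eq, ← (hrep (k + j) (by omega)).value_eq, hij]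
      simp only [gap, this]
    -- Weights determine the iterate, so strict decrease excludes repetition. The window then shows
    -- B + 1 distinct weights, one too many.
    have hlen := length_le_of_isDropOrSwap (V := V) (μ := fun j => μ (k + j)) (W := B)
      (fun j hj => by
        have hj1 : 1 ≤ k + j := by omega
        have hb := hbad (k + j) (by omega) (by omega)
        have hup := R.update (k + j) hj1
        rw [hb.1] at hup
        exact isDropOrSwap_of_isUpdate (finite_vertices.mem_toFinset.2 (R.oracle_mem _ hj1))
          (R.away_mem _ hj1) hb.2.1 hup)
      (fun j _ w hw => finite_vertices.mem_toFinset.2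
        ((hrep (k + j) (by omega)).support_subset w hw))
      (fun i hi j hj hij => by
        rcases lt_trichotomy i j with h | h | h
        · exact ((hdecr i j h hj).ne (hval i j hij).symm).elim
        · exact h
        · exact ((hdecr j i h hi).ne (hval i j hij)).elim)
    rw [hVcard] at hlen
    omega

end Path

/-! ### Mean deviation of uniform samples. -/

section Sampling

variable {n : ℕ} {Ω : Type*} [MeasurableSpace Ω] {P : Measure Ω}

lemma sampleDev_le {m : ℕ} (s : ℕ → Fin n) : sampleDev m s ≤ 2 * n := by
  have h : ∀ j : Fin n, |(((Finset.range m).filter fun i => s i = j).card : ℝ) / m - 1 / n| ≤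
      2 := by
    intro j
    have hn : (1 : ℝ) ≤ n := by exact_mod_cast j.pos
    have h1 : (((Finset.range m).filter fun i => s i = j).card : ℝ) / m ≤ 1 := by
      refine div_le_one_of_le₀ ?_ (by positivity)
      exact_mod_cast (Finset.card_filter_le _ _).trans (Finset.card_range m).le
    have h2 : 0 ≤ (((Finset.range m).filter fun i => s i = j).card : ℝ) / m := by positivity
    have h3 : 1 / (n : ℝ) ≤ 1 := div_le_one_of_le₀ hn (by positivity)
    have h4 : 0 ≤ 1 / (n : ℝ) := by positivity
    rw [abs_le]
    constructor <;> linarith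
  refine (Finset.sum_le_sum fun j _ => h j).trans_eq ?_
  simp [mul_comm]

lemma measurable_sampleDev {m : ℕ} {X : ℕ → Ω → Fin n} (hX : ∀ i, Measurable (X i)) :
    Measurable fun ω => sampleDev m fun i => X i ω := by
  unfold sampleDev
  refine Finset.measurable_sum _ fun j _ => ?_
  simp only [Finset.card_filter, Nat.cast_sum]
  have : ∀ i, Measurable fun ω => (((if X i ω = j then 1 else 0 : ℕ)) : ℝ) := fun i =>
    (measurable_from_top (f := fun a : Fin n => (((if a = j then 1 else 0 : ℕ)) : ℝ))).comp (hX i)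
  have h := Finset.measurable_sum (Finset.range m) fun i _ => this i
  exact ((h.div_const _).sub_const _).norm

lemma integrable_sampleDev [IsFiniteMeasure P] {m : ℕ} {X : ℕ → Ω → Fin n}
    (hX : ∀ i, Measurable (X i)) : Integrable (fun ω => sampleDev m fun i => X i ω) P := by
  refine Integrable.of_bound (measurable_sampleDev hX).aestronglyMeasurable (2 * n)
    (Filter.Eventually.of_forall fun ω => ?_)
  rw [Real.norm_of_nonneg (sampleDev_nonneg _)]
  exact sampleDev_le _

/-- The mean deviation of a sample of size `m` is of order `m ^ (-1/2)`. -/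
lemma integral_sampleDev_le [IsProbabilityMeasure P] {m : ℕ} (hm : 0 < m)
    {X : ℕ → Ω → Fin n} (hX : ∀ i, Measurable (X i)) (hind : iIndepFun X P)
    (hunif : ∀ i j, P.real {ω | X i ω = j} = 1 / (n : ℝ)) :
    ∫ ω, sampleDev m (fun i => X i ω) ∂P ≤ n / √m := by
  have hm' : (0 : ℝ) < m := by exact_mod_cast hm
  have hsq : 0 < √(m : ℝ) := Real.sqrt_pos.2 hm'
  set φ : Fin n → Fin n → ℝ := fun j a => ((if a = j then 1 else 0 : ℕ) : ℝ) with hφ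
  set Y : Fin n → ℕ → Ω → ℝ := fun j i ω => φ j (X i ω) with hY
  have hYm : ∀ j i, Measurable (Y j i) := fun j i => (measurable_from_top (f := φ j)).comp (hX i)
  have hYb : ∀ j i ω, ‖Y j i ω‖ ≤ 1 := by
    intro j i ω
    simp only [hY, hφ]
    split_ifs <;> simp
  have hYL : ∀ j i, MemLp (Y j i) 2 P := fun j i =>
    MemLp.of_bound (hYm j i).aestronglyMeasurable 1 (Filter.Eventually.of_forall (hYb j i))
  have hYE : ∀ j i, ∫ ω, Y j i ω ∂P = 1 / n := by
    intro j i
    have hset : MeasurableSet {ω | X i ω = j} := hX i (measurableSet_singleton j)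
    have : Y j i = Set.indicator {ω | X i ω = j} 1 := by
      ext ω
      by_cases h : X i ω = j <;> simp [hY, hφ, h]
    rw [this, integral_indicator_one hset, hunif]
  have hYV : ∀ j i, variance (Y j i) P ≤ 1 := by
    intro j i
    refine (variance_le_expectation_sq (hYm j i).aestronglyMeasurable).trans ?_
    have : ∀ ω, (Y j i ^ 2) ω ≤ 1 := fun ω => by
      have := hYb j i ω
      rw [Real.norm_eq_abs] at this
      simpa using (sq_le_one_iff_abs_le_one _).2 this
    calc ∫ ω, (Y j i ^ 2) ω ∂P ≤ ∫ _ω, (1 : ℝ) ∂P :=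
          integral_mono ((hYL j i).integrable_sq) (integrable_const 1) this
      _ = 1 := by simp
  set Z : Fin n → Ω → ℝ := fun j => ∑ i ∈ Finset.range m, Y j i with hZ
  have hZL : ∀ j, MemLp (Z j) 2 P := fun j => memLp_finsetSum' _ fun i _ => hYL j i
  have hZE : ∀ j, ∫ ω, Z j ω ∂P = m / n := by
    intro j
    simp only [hZ, Finset.sum_apply]
    rw [integral_finsetSum _ fun i _ => (hYL j i).integrable one_le_two]
    simp [hYE, div_eq_mul_inv]
  have hZV : ∀ j, variance (Z j) P ≤ m := by
    intro j
    rw [hZ, IndepFun.variance_sum (fun i _ => hYL j i) fun i _ l _ hil =>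
      (hind.indepFun hil).comp (measurable_from_top (f := φ j)) (measurable_from_top (f := φ j))]
    exact (Finset.sum_le_sum fun i _ => hYV j i).trans_eq (by simp)
  have hterm : ∀ j, ∫ ω, |Z j ω / m - 1 / n| ∂P ≤ 1 / √m := by
    intro j
    have hvar : ∫ ω, (Z j ω - m / n) ^ 2 ∂P ≤ m := by
      have := hZV j
      rwa [variance_eq_integral (hZL j).aestronglyMeasurable.aemeasurable, hZE j] at this
    have hint : Integrable (fun ω => (Z j ω - m / n) ^ 2) P :=
      ((hZL j).sub (memLp_const (m / n : ℝ))).integrable_sq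
    -- The inequality 2|a|√m ≤ a² + m passes from the variance to the absolute moment; at variance m
    -- both terms contribute 1 / (2√m).
    have hpt : ∀ ω, |Z j ω / m - 1 / n| ≤
        1 / (2 * (m * √m)) * (Z j ω - m / n) ^ 2 + 1 / (2 * √m) := by
      intro ω
      set a := Z j ω - m / n with ha
      have h1 : Z j ω / m - 1 / n = a / m := by
        rw [ha]; field_simp
      have h2 : √(m : ℝ) * √m = m := Real.mul_self_sqrt hm'.le
      rw [h1, abs_div, abs_of_pos hm', ← sq_abs a, div_le_iff₀ hm']
      have h3 : (1 / (2 * (m * √m)) * |a| ^ 2 + 1 / (2 * √m)) * m =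
          (|a| ^ 2 + m) / (2 * √m) := by
        field_simp
      rw [h3, le_div_iff₀ (by positivity)]
      nlinarith [sq_nonneg (|a| - √m)]
    calc ∫ ω, |Z j ω / m - 1 / n| ∂P
        ≤ ∫ ω, (1 / (2 * (m * √m)) * (Z j ω - m / n) ^ 2 + 1 / (2 * √m)) ∂P := by
          refine integral_mono ?_ ((hint.const_mul _).add (integrable_const _)) hpt
          exact ((((hZL j).integrable one_le_two).div_const _).sub (integrable_const _)).abs
      _ = 1 / (2 * (m * √m)) * ∫ ω, (Z j ω - m / n) ^ 2 ∂P + 1 / (2 * √m) := by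
          rw [integral_add (hint.const_mul _) (integrable_const _), integral_const_mul]
          simp
      _ ≤ 1 / (2 * (m * √m)) * m + 1 / (2 * √m) := by gcongr
      _ = 1 / √m := by field_simp; norm_num
  have hdev : ∀ ω, sampleDev m (fun i => X i ω) = ∑ j, |Z j ω / m - 1 / n| := by
    intro ω
    refine Finset.sum_congr rfl fun j _ => ?_
    simp only [hZ, hY, hφ, Finset.card_filter, Nat.cast_sum, Finset.sum_apply]
  simp only [hdev]
  have hint : ∀ j, Integrable (fun ω => |Z j ω / m - 1 / n|) P := fun j =>
    ((((hZL j).integrable one_le_two).div_const _).sub (integrable_const _)).abs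
  rw [integral_finsetSum _ fun j _ => hint j]
  exact (Finset.sum_le_sum fun j _ => hterm j).trans_eq (by simp [div_eq_mul_inv])

end Sampling

/-! ### Geometric decay and growth of the work. -/

section Rate

/-- The rate `(1 - κ) ^ (2 / (B + 1))`. -/
noncomputable def rate (κ : ℝ) (B : ℕ) : ℝ := (1 - κ) ^ ((2 : ℝ) / (B + 1))

variable {κ : ℝ} {B : ℕ}

lemma rate_pos (h1 : κ < 1) : 0 < rate κ B := Real.rpow_pos_of_pos (by linarith) _

lemma rate_lt_one (h0 : 0 < κ) (h1 : κ < 1) : rate κ B < 1 :=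
  Real.rpow_lt_one (by linarith) (by linarith) (by positivity)

lemma rate_pow (h1 : κ < 1) (k : ℕ) : rate κ B ^ k = ((1 - κ) ^ 2) ^ ((k : ℝ) / (B + 1)) := by
  have h : (0 : ℝ) ≤ 1 - κ := by linarith
  rw [rate, ← Real.rpow_natCast, ← Real.rpow_mul h, ← Real.rpow_natCast (1 - κ) 2,
    ← Real.rpow_mul h]
  congr 1
  push_cast
  ring

/-- This motivates the exponent 2 / (B + 1): decay over B + 1 iterations matches the growth of the
sample size in one. -/
lemma rate_pow_succ (h1 : κ < 1) : rate κ B ^ (B + 1) = (1 - κ) ^ 2 := by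
  rw [rate_pow h1]
  push_cast
  rw [div_self (by positivity), Real.rpow_one]

lemma one_sub_le_rate (h0 : 0 < κ) (h1 : κ < 1) (hB : 1 ≤ B) : 1 - κ ≤ rate κ B := by
  have hB' : (1 : ℝ) ≤ B := by exact_mod_cast hB
  have h : (2 : ℝ) / (B + 1) ≤ 1 := by
    rw [div_le_one (by positivity)]; linarith
  have h2 := Real.rpow_le_rpow_of_exponent_ge (by linarith : (0 : ℝ) < 1 - κ) (by linarith) h
  rwa [Real.rpow_one] at h2

/-- A sequence that contracts every `B` steps, up to a geometrically decaying error, decays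
geometrically. -/
lemma le_rate_pow_of_window (h0 : 0 < κ) (h1 : κ ≤ 1 / 8) (hB : 1 ≤ B) {H E : ℝ} (hH : 0 ≤ H)
    (hE : 0 ≤ E) {e : ℕ → ℝ} (hbound : ∀ k, 1 ≤ k → e k ≤ H)
    (hrec : ∀ k, 1 ≤ k → e (k + B) ≤ (1 - 8 * κ) * e k + E * (1 - κ) ^ k) {k : ℕ} (hk : 1 ≤ k) :
    e k ≤ (H / rate κ B ^ B + E / κ) * rate κ B ^ k := by
  have hκ1 : κ < 1 := by linarith
  set τ := rate κ B with hτ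
  have hτ0 : 0 < τ := rate_pos hκ1
  have hτ1 : τ < 1 := rate_lt_one h0 hκ1
  have hτκ : 1 - κ ≤ τ := one_sub_le_rate h0 hκ1 hB
  have hτB : 1 - 2 * κ ≤ τ ^ B := by
    have h2 : τ ^ (B + 1) = (1 - κ) ^ 2 := rate_pow_succ hκ1
    have h3 : τ ^ (B + 1) ≤ τ ^ B := pow_le_pow_of_le_one hτ0.le hτ1.le (Nat.le_succ B)
    nlinarith [sq_nonneg κ]
  -- The first summand covers the initial B indices. The second gives E ≤ κ c, so the step needs
  -- only 1 - 8κ + κ ≤ 1 - 2κ ≤ τ^B.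
  set c := H / τ ^ B + E / κ with hc
  have hc0 : 0 ≤ c := by positivity
  induction k using Nat.strong_induction_on with
  | _ k ih =>
    rcases le_or_gt k B with hkB | hkB
    · calc e k ≤ H := hbound k hk
        _ = H / τ ^ B * τ ^ B := by field_simp
        _ ≤ c * τ ^ k := by
            have h2 : τ ^ B ≤ τ ^ k := pow_le_pow_of_le_one hτ0.le hτ1.le hkB
            have h3 : H / τ ^ B ≤ c := le_add_of_nonneg_right (by positivity)
            exact mul_le_mul h3 h2 (by positivity) hc0
    · obtain ⟨l, rfl⟩ := Nat.exists_eq_add_of_lt hkB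
      rw [show B + l + 1 = (l + 1) + B by ring]
      have h2 := ih (l + 1) (by omega) (by omega)
      have h3 := mul_le_mul_of_nonneg_left h2 (by linarith : 0 ≤ 1 - 8 * κ)
      have h4 : (1 - κ) ^ (l + 1) ≤ τ ^ (l + 1) := pow_le_pow_left₀ (by linarith) hτκ _
      have h5 : E ≤ κ * c := by
        rw [hc, mul_add, mul_div_cancel₀ _ h0.ne']
        exact le_add_of_nonneg_left (by positivity)
      have hpos : 0 < τ ^ (l + 1) := pow_pos hτ0 _
      have h6 : E * (1 - κ) ^ (l + 1) ≤ κ * c * τ ^ (l + 1) :=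
        mul_le_mul h5 h4 (by have : 0 ≤ 1 - κ := by linarith
                             positivity) (by positivity)
      have h7 := mul_le_mul_of_nonneg_left hτB (mul_nonneg hc0 hpos.le)
      have h8 : 0 ≤ κ * (c * τ ^ (l + 1)) := by positivity
      rw [pow_add]
      linarith [hrec (l + 1) (by omega)]

lemma sampleSize_pos (h1 : κ < 1) (k : ℕ) : 0 < sampleSize κ k := by
  have : 0 < 1 - κ := by linarith
  exact Nat.ceil_pos.2 (by positivity)

/-- The sample size is at least the square of (1 - κ)^(-(k + 1)), so the sampling error decays
geometrically. -/
lemma div_sqrt_sampleSize_le (h1 : κ < 1) (k n : ℕ) :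
    (n : ℝ) / √(sampleSize κ k) ≤ n * (1 - κ) ^ (k + 1) := by
  have h : 0 < 1 - κ := by linarith
  have h2 : ((1 - κ) ^ (k + 1))⁻¹ ≤ √(sampleSize κ k) := by
    refine Real.le_sqrt_of_sq_le ?_
    refine le_trans (le_of_eq ?_) (Nat.le_ceil _)
    rw [inv_pow, ← pow_mul, one_div]
    ring_nf
  rw [div_eq_mul_inv]
  exact mul_le_mul_of_nonneg_left (inv_le_of_inv_le₀ (by positivity) h2) (by positivity)

/-- The number of gradient evaluations grows at most geometrically. -/
lemma gradEvals_le (h0 : 0 < κ) (h1 : κ < 1) :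
    ∃ T, 0 ≤ T ∧ ∀ k, (gradEvals κ k : ℝ) ≤ T * (((1 - κ) ^ 2)⁻¹) ^ k := by
  have h : 0 < 1 - κ := by linarith
  set a := ((1 - κ) ^ 2)⁻¹ with ha
  have ha1 : 1 < a := by
    refine (one_lt_inv₀ (by positivity)).2 ?_
    nlinarith
  refine ⟨2 * a ^ 2 / (a - 1), div_nonneg (by positivity) (by linarith), fun k => ?_⟩
  -- Chosen so that T a^k grows per step by 2 a^(k + 2), which dominates a^(k + 2) + 1 and hence the
  -- rounded-up sample size.
  set T := 2 * a ^ 2 / (a - 1) with hT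
  have hTa : T * (a - 1) = 2 * a ^ 2 := div_mul_cancel₀ _ (by linarith)
  induction k with
  | zero =>
    have : 0 ≤ T := div_nonneg (by positivity) (by linarith)
    simpa [gradEvals] using this
  | succ k ih =>
    have h2 : gradEvals κ (k + 1) = gradEvals κ k + sampleSize κ (k + 1) :=
      Finset.sum_Icc_succ_top (by omega) _
    have h3 : (sampleSize κ (k + 1) : ℝ) ≤ a ^ (k + 2) + 1 := by
      refine (Nat.ceil_lt_add_one (by positivity)).le.trans_eq ?_
      rw [ha, inv_pow, ← pow_mul, one_div]
      ring_nf
    have h4 : 1 ≤ a ^ (k + 2) := one_le_pow₀ ha1.le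
    have h5 : T * a ^ (k + 1) = T * a ^ k + 2 * a ^ (k + 2) := by
      have : T * a ^ (k + 1) = T * a ^ k + T * (a - 1) * a ^ k := by ring
      rw [this, hTa]
      ring
    rw [h2, h5]
    push_cast
    linarith

end Rate

/-! ### From sample paths to expectations. -/

section Expectation

variable {p r n : ℕ} {C : Fin r → Eucl p} {d : Fin r → ℝ} {f : Fin n → Eucl p → ℝ}
  {σ L : Fin n → ℝ} {var : Variant}

/-- The parameter `κ` and its half `ρ`, without the minimum. -/
lemma kappa_rho_eq (hn : 0 < n) (H : IsSmoothStrong f σ L)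
    (hbdd : Bornology.IsBounded (polyhedron C d)) (hnt : (polyhedron C d).Nontrivial) :
    0 < kappa C d σ L var ∧ kappa C d σ L var ≤ 1 / 8 ∧
      kappa C d σ L var = 2 * rho C d σ L var ∧
      8 * kappa C d σ L var * ((repSize C d var : ℝ) ^ 2 * (⨆ i, L i) *
        Metric.diam (polyhedron C d) ^ 2) = vertexFacetConst C d ^ 2 * ⨅ i, σ i := by
  obtain ⟨a, -, b, -, hab⟩ := id hnt
  have hσ := H.ciInf_pos hn
  have hσL := H.ciInf_le_ciSup hn hab
  have hL : 0 < ⨆ i, L i := hσ.trans_le hσL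
  have hD := diam_polyhedron_pos hbdd hnt
  have hΩ := vertexFacetConst_pos hbdd hnt
  have hΩD := vertexFacetConst_le_diam hbdd hnt
  have hN : (1 : ℝ) ≤ repSize C d var := by
    exact_mod_cast one_le_repSize (nontrivial_vertices hbdd hnt).nonempty
  unfold kappa rho contraction
  set Ω := vertexFacetConst C d
  set D := Metric.diam (polyhedron C d)
  set N : ℝ := (repSize C d var : ℝ)
  set τ := ⨅ i, σ i
  set ℓ := ⨆ i, L i
  have hW : 0 < N ^ 2 * ℓ * D ^ 2 := by positivity
  set R := Ω ^ 2 * τ / (N ^ 2 * ℓ * D ^ 2) with hR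
  have hR0 : 0 < R := by positivity
  -- From Ω ≤ D, σ_F ≤ L_F and N ≥ 1; hence R / 8 and R / 16 are below 1/2.
  have hR1 : R ≤ 1 := by
    rw [hR, div_le_one hW]
    calc Ω ^ 2 * τ ≤ D ^ 2 * ℓ := by gcongr
      _ = 1 ^ 2 * ℓ * D ^ 2 := by ring
      _ ≤ N ^ 2 * ℓ * D ^ 2 := by gcongr
  have hRW : R * (N ^ 2 * ℓ * D ^ 2) = Ω ^ 2 * τ := div_mul_cancel₀ _ hW.ne'
  have h8 : Ω ^ 2 * τ / (8 * N ^ 2 * ℓ * D ^ 2) = R / 8 := by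
    rw [hR, div_div]; congr 1; ring
  have h16 : Ω ^ 2 * τ / (16 * N ^ 2 * ℓ * D ^ 2) = R / 16 := by
    rw [hR, div_div]; congr 1; ring
  rw [h8, h16, min_eq_right (by linarith), min_eq_right (by linarith)]
  refine ⟨by linarith, by linarith, by linarith, ?_⟩
  rw [← hRW]
  ring

/-- The expected accuracy of all runs decays geometrically, uniformly in the run. -/
lemma exists_expectedGap_le.{w} (hn : 0 < n) (H : IsSmoothStrong f σ L)
    (hbdd : Bornology.IsBounded (polyhedron C d)) (hnt : (polyhedron C d).Nontrivial)
    (var : Variant) :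
    ∃ c : ℝ, 0 ≤ c ∧ ∀ (Ω : Type w) [MeasurableSpace Ω] (P : Measure Ω) [IsProbabilityMeasure P]
      (ξ : ℕ → ℕ → Ω → Fin n) (x : ℕ → Ω → Eucl p) (μ : ℕ → Ω → Eucl p →₀ ℝ)
      (v u : ℕ → Ω → Eucl p) (γ : ℕ → Ω → ℝ),
      IsRandomRun C d f σ L var P ξ x μ v u γ → ∀ k, expectedGap C d f P x k ≤
        c * rate (kappa C d σ L var) (3 * (vertices C d).ncard.factorial) ^ (k + 1) := by
  obtain ⟨hκ0, hκ8, -, hκ⟩ := kappa_rho_eq (var := var) hn H hbdd hnt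
  set κ := kappa C d σ L var with hκdef
  have hκ1 : κ < 1 := by linarith
  set B := 3 * (vertices C d).ncard.factorial with hB
  have hB1 : 1 ≤ B := by
    have := Nat.factorial_pos (vertices C d).ncard
    omega
  obtain ⟨G, hG0, hG⟩ := H.exists_lipschitz hbdd
  obtain ⟨A, hA0, hA⟩ := IsRun.contraction_window (var := var) hn H hbdd hnt hG0 hG
    (by linarith : 0 ≤ 8 * κ) (by linarith) hκ.le
  have hcont : Continuous fun z => objective f z - optValue C d f :=
    H.continuous_objective.sub continuous_const
  obtain ⟨M, hM⟩ := (isCompact_polyhedron hbdd).exists_bound_of_continuousOn hcont.continuousOn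
  have hM0 : 0 ≤ M := by
    obtain ⟨z, hz⟩ := hnt.nonempty
    exact (norm_nonneg _).trans (hM z hz)
  set E : ℝ := A * (B * n) with hE
  have hE0 : 0 ≤ E := by positivity
  have hrate : 0 < rate κ B := rate_pos hκ1
  refine ⟨M / rate κ B ^ B + E / κ, by positivity, ?_⟩
  intro Ω _ P _ ξ x μ v u γ R k
  set gap : ℕ → Ω → ℝ := fun k ω => objective f (x k ω) - optValue C d f with hgap
  have hbound : ∀ k, 1 ≤ k → ∀ ω, ‖gap k ω‖ ≤ M := fun k hk ω =>
    hM _ ((R.run ω).representation H hnt (sampleSize_pos hκ1) hk).mem_polyhedron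
  have hint : ∀ k, 1 ≤ k → Integrable (gap k) P := fun k hk =>
    Integrable.of_bound (hcont.measurable.comp (R.iterate_measurable k hk)).aestronglyMeasurable M
      (Filter.Eventually.of_forall (hbound k hk))
  set δ : ℕ → Ω → ℝ := fun j ω => sampleDev (sampleSize κ j) fun i => ξ j i ω with hδ
  have hδint : ∀ j, Integrable (δ j) P := fun j => integrable_sampleDev (R.sample_measurable j)
  -- Only independence within iteration j enters, because the deviation bound is uniform in the
  -- iterate.
  have hδE : ∀ j, ∫ ω, δ j ω ∂P ≤ n * (1 - κ) ^ (j + 1) := fun j =>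
    (integral_sampleDev_le (sampleSize_pos hκ1 j) (R.sample_measurable j)
      (R.sample_indep.precomp (g := fun i => (j, i)) fun a b h => (Prod.mk.inj h).2)
      (R.sample_uniform j)).trans (div_sqrt_sampleSize_le hκ1 j n)
  refine le_rate_pow_of_window hκ0 hκ8 hB1 hM0 hE0 (e := fun k => ∫ ω, gap k ω ∂P)
    (fun k hk => ?_) (fun k hk => ?_) (Nat.le_add_left 1 k)
  · calc ∫ ω, gap k ω ∂P ≤ ∫ _ω, M ∂P :=
          integral_mono (hint k hk) (integrable_const M) fun ω =>
            (le_abs_self _).trans (hbound k hk ω)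
      _ = M := by simp
  · have hsum : Integrable (fun ω => ∑ j ∈ Finset.Ico k (k + B), δ j ω) P :=
      integrable_finsetSum _ fun j _ => hδint j
    have h1 : ∫ ω, gap (k + B) ω ∂P ≤
        ∫ ω, ((1 - 8 * κ) * gap k ω + A * ∑ j ∈ Finset.Ico k (k + B), δ j ω) ∂P :=
      integral_mono (hint _ (by omega)) (((hint k hk).const_mul _).add (hsum.const_mul _))
        fun ω => hA _ _ _ _ _ _ _ (sampleSize_pos hκ1) (R.run ω) k hk
    rw [integral_add ((hint k hk).const_mul _) (hsum.const_mul _), integral_const_mul,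
      integral_const_mul, integral_finsetSum _ fun j _ => hδint j] at h1
    have h2 : ∑ j ∈ Finset.Ico k (k + B), ∫ ω, δ j ω ∂P ≤ B * n * (1 - κ) ^ k := by
      calc ∑ j ∈ Finset.Ico k (k + B), ∫ ω, δ j ω ∂P
          ≤ ∑ _j ∈ Finset.Ico k (k + B), n * (1 - κ) ^ k := by
            refine Finset.sum_le_sum fun j hj => (hδE j).trans ?_
            refine mul_le_mul_of_nonneg_left ?_ (by positivity)
            refine pow_le_pow_of_le_one (by linarith) (by linarith) ?_
            exact (Finset.mem_Ico.1 hj).1.trans (Nat.le_succ j)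
        _ = B * n * (1 - κ) ^ k := by simp [mul_assoc]
    have h3 := mul_le_mul_of_nonneg_left h2 hA0
    have h4 : A * (B * n * (1 - κ) ^ k) = E * (1 - κ) ^ k := by rw [hE]; ring
    linarith

end Expectation

end PSFW

theorem corollary5 {p r n : ℕ} (hn : 0 < n)
    (C : Fin r → PSFW.Eucl p) (d : Fin r → ℝ)
    (hbdd : Bornology.IsBounded (PSFW.polyhedron C d))
    (hnontriv : (PSFW.polyhedron C d).Nontrivial)
    (f : Fin n → PSFW.Eucl p → ℝ) (σ L : Fin n → ℝ)
    (hσ : ∀ i, 0 < σ i)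
    (hconv : ∀ i, StrongConvexOn Set.univ (σ i) (f i))
    (hdiff : ∀ i, Differentiable ℝ (f i))
    (hlip : ∀ i x y, ‖gradient (f i) x - gradient (f i) y‖ ≤ L i * ‖x - y‖)
    (var : PSFW.Variant) :
    ∃ φ ζ C₃ K : ℝ,
      0 < φ ∧ φ < PSFW.kappa C d σ L var ∧
      ζ = Real.log (1 - PSFW.rho C d σ L var) / Real.log (1 - φ) ∧ 0 < ζ ∧ ζ < 1 ∧
      ∀ (Ω : Type*) [MeasurableSpace Ω] (P : MeasureTheory.Measure Ω)
        [MeasureTheory.IsProbabilityMeasure P]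
        (ξ : ℕ → ℕ → Ω → Fin n) (x : ℕ → Ω → PSFW.Eucl p) (μ : ℕ → Ω → PSFW.Eucl p →₀ ℝ)
        (v u : ℕ → Ω → PSFW.Eucl p) (γ : ℕ → Ω → ℝ),
        PSFW.IsRandomRun C d f σ L var P ξ x μ v u γ →
          (∀ k : ℕ, 1 ≤ k → PSFW.expectedGap C d f P x k ≤
            C₃ * (1 - φ) ^ ((k : ℝ) / (3 * ((PSFW.vertices C d).ncard.factorial : ℝ) + 1))) ∧
          ∀ ε : ℝ, 0 < ε → ε < 1 →
            ∃ k : ℕ, IsLeast {j : ℕ | PSFW.expectedGap C d f P x j ≤ ε} k ∧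
              (PSFW.gradEvals (PSFW.kappa C d σ L var) k : ℝ) ≤
                K * (1 / ε) ^ ((6 * ((PSFW.vertices C d).ncard.factorial : ℝ) + 2) * ζ) := by
  classical
  have H : PSFW.IsSmoothStrong f σ L := ⟨hσ, hconv, hdiff, hlip⟩
  obtain ⟨hκ0, hκ8, hκρ, -⟩ := PSFW.kappa_rho_eq (var := var) hn H hbdd hnontriv
  obtain ⟨c, hc0, hc⟩ := PSFW.exists_expectedGap_le hn H hbdd hnontriv var
  set κ := PSFW.kappa C d σ L var with hκ
  set ρ := PSFW.rho C d σ L var with hρ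
  set M := (PSFW.vertices C d).ncard.factorial with hM
  have hκ1 : κ < 1 := by linarith
  obtain ⟨T, hT0, hT⟩ := PSFW.gradEvals_le hκ0 hκ1
  set τ := PSFW.rate κ (3 * M) with hτ
  have hτ0 : 0 < τ := PSFW.rate_pos hκ1
  have hτ1 : τ < 1 := PSFW.rate_lt_one hκ0 hκ1
  have hφ : 1 - (1 - (1 - ρ) ^ 2) = (1 - ρ) ^ 2 := by ring
  have hlog : Real.log (1 - ρ) < 0 := Real.log_neg (by linarith) (by linarith)
  have hζ : Real.log (1 - ρ) / Real.log (1 - (1 - (1 - ρ) ^ 2)) = 1 / 2 := by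
    rw [hφ, Real.log_pow]
    have := hlog.ne
    push_cast
    field_simp
  -- With κ = 2ρ, this φ equals κ - ρ² < κ.
  refine ⟨1 - (1 - ρ) ^ 2, 1 / 2, c, T * c ^ (3 * M + 1), by nlinarith, by nlinarith, hζ.symm,
    by norm_num, by norm_num, ?_⟩
  intro Ω _ P _ ξ x μ v u γ R
  have hgap := hc Ω P ξ x μ v u γ R
  refine ⟨fun k _ => (hgap k).trans (mul_le_mul_of_nonneg_left ?_ hc0), fun ε hε _ => ?_⟩
  · calc τ ^ (k + 1) ≤ τ ^ k := pow_le_pow_of_le_one hτ0.le hτ1.le (Nat.le_succ k)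
      _ = ((1 - κ) ^ 2) ^ ((k : ℝ) / (3 * (M : ℝ) + 1)) := by
          rw [hτ, PSFW.rate_pow hκ1]
          push_cast
          rfl
      _ ≤ _ := by
          rw [hφ]
          refine Real.rpow_le_rpow (by positivity) ?_ (by positivity)
          nlinarith
  · have hex : ∃ j, PSFW.expectedGap C d f P x j ≤ ε := by
      have hlim : Filter.Tendsto (fun j => c * τ ^ (j + 1)) Filter.atTop (nhds (c * 0)) :=
        ((tendsto_pow_atTop_nhds_zero_of_lt_one hτ0.le hτ1).comp
          (Filter.tendsto_add_atTop_nat 1)).const_mul c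
      rw [mul_zero] at hlim
      obtain ⟨j, hj⟩ := (hlim.eventually (eventually_lt_nhds hε)).exists
      exact ⟨j, (hgap j).trans hj.le⟩
    refine ⟨Nat.find hex, ⟨Nat.find_spec hex, fun j hj => Nat.find_min' hex hj⟩, ?_⟩
    set k := Nat.find hex with hk
    have hexp : (1 / ε) ^ ((6 * (M : ℝ) + 2) * (1 / 2)) = (1 / ε) ^ (3 * M + 1) := by
      rw [← Real.rpow_natCast]
      congr 1
      push_cast
      ring
    rw [hexp]
    -- For k = 0 nothing is evaluated. Otherwise k - 1 iterations miss ε, and their bound has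
    -- exponent (k - 1) + 1 = k.
    rcases Nat.eq_zero_or_pos k with h0 | hpos
    · rw [h0]
      simp only [PSFW.gradEvals, Finset.Icc_eq_empty_of_lt zero_lt_one, Finset.sum_empty,
        Nat.cast_zero]
      positivity
    · have hlt : ε < c * τ ^ k := by
        have h1 : ε < PSFW.expectedGap C d f P x (k - 1) :=
          not_le.1 (Nat.find_min hex (Nat.sub_lt hpos one_pos))
        have h2 := hgap (k - 1)
        rw [Nat.sub_add_cancel hpos] at h2
        exact h1.trans_le h2
      have hpow : τ ^ (3 * M + 1) = (1 - κ) ^ 2 := PSFW.rate_pow_succ hκ1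
      have hle : (τ ^ k)⁻¹ ≤ c * (1 / ε) := by
        rw [inv_le_iff_one_le_mul₀ (by positivity), mul_one_div, div_mul_eq_mul_div,
          one_le_div hε]
        exact hlt.le
      calc (PSFW.gradEvals κ k : ℝ) ≤ T * (((1 - κ) ^ 2)⁻¹) ^ k := hT k
        _ = T * ((τ ^ k)⁻¹) ^ (3 * M + 1) := by
            rw [← hpow, inv_pow, inv_pow, ← pow_mul, ← pow_mul, mul_comm k]
        _ ≤ T * (c * (1 / ε)) ^ (3 * M + 1) := by gcongr
        _ = T * c ^ (3 * M + 1) * (1 / ε) ^ (3 * M + 1) := by rw [mul_pow, mul_assoc]
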